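/- **Setting.** Let $\mathbb X,\mathbb Y$ be real Banach spaces, $\mathbb X$ reflexive, $C\subset\mathbb Y$ a nonempty closed convex cone, $\Omega\subseteq\mathbb X$ open, $F:\Omega\to\mathbb Y$ continuously Fréchet differentiable and $x_0\in\Omega$. For a set $S$ put $\|S\|:=\inf\{\|v\|:v\in S\}$ ($+\infty$ if $S=\varnothing$), and for a set-valued map $T$ put $\|T\|:=\sup\{\|Td\|: Td\neq\varnothing,\ \|d\|\le 1\}$. Let $T_{x_0}d:=F'(x_0)d-C$, so that $T_{x_0}^{-1}y=\{d\in\mathbb X: F'(x_0)d-y\in C\}$, and assume Robinson's condition $\bigcup_{d\in\mathbb X}T_{x_0}d=\mathbb Y$. Let $R>0$ and let $f:[0,R)\to\mathbb R$ be a majorant function for $F$ at $x_0$: $f$ is $C^1$, $B(x_0,R)\subseteq\Omega$, $$\|T_{x_0}^{-1}[F'(y)-F'(x)]\|\le f'(\|x-x_0\|+\|y-x\|)-f'(\|x-x_0\|)$$ for all $x,y\in B(x_0,R)$ with $\|x-x_0\|+\|y-x\|<R$, $f(0)>0$, $f'(0)=-1$, $f'$ is convex and strictly increasing, and $f(t)=0$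 for some $t\in(0,R)$. Assume $\|T_{x_0}^{-1}[-F(x_0)]\|\le f(0)$. Put $$\kappa:=\sup_{0<t<R}\frac{-f(t)}{t},\quad \lambda:=\sup\{t\in[0,R):\kappa+f'(t)<0\},\quad \tilde\theta:=\frac{\kappa}{2-\kappa},\quad \bar t:=\sup\{t\in[0,R):f'(t)<0\},$$ $$n_\theta(t,\varepsilon):=\Big(t-(1+\theta)\frac{f(t)+\varepsilon}{f'(t)},\ \varepsilon+2\theta(f(t)+\varepsilon)\Big)\quad\text{on }[0,\bar t)\times[0,\infty),$$ $$\mathcal A:=\{(t,\varepsilon):0\le t<\lambda,\ 0\le\varepsilon\le\kappa t,\ 0<f(t)+\varepsilon\},$$ $$K(t,\varepsilon):=\{x\in\mathbb X:\|x-x_0\|\le t,\ \|T_{x_0}^{-1}[-F(x)]\|\le f(t)+\varepsilon\}.$$ For $x\in B(x_0,\bar t)$ call $r\in\mathbb Y$ an allowed residual at $x$ if $\max_{w\in\{-r,r\}}\|T_{x_0}^{-1}w\|\le\theta\|T_{x_0}^{-1}[-F(x)]\|$. An inexact Newton iteration mapping $N$ assigns to each $x\in B(x_0,\bar t)$ the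 set $N(x)=x+\bigcup_{r\in S_x}\operatorname{argmin}_{d\in\mathbb X}\{\|d\|:F(x)+F'(x)d+r\in C\}$, where $S_x$ is some nonempty set of allowed residuals at $x$ (for instance a single one, or all of them). **Theorem.** Let $0\le\theta\le\tilde\theta$, let $N$ be an inexact Newton iteration mapping, $(t_0,\varepsilon_0)\in\mathcal A$ and $y_0\in K(t_0,\varepsilon_0)$. Then the sequences $$y_{k+1}\in N(y_k),\qquad (t_{k+1},\varepsilon_{k+1})=n_\theta(t_k,\varepsilon_k),\qquad k=0,1,\dots$$ are well defined (the iterates stay in the domains of $N$ and $n_\theta$, and $N(y_k)\ne\varnothing$ at every step, whatever the previous choices). The sequence $\{t_k\}$ is strictly increasing and converges to some $\tilde t\in(0,\lambda]$, and $\{\varepsilon_k\}$ is non-decreasing and converges to some $\tilde\varepsilon\in[0,\kappa\lambda]$. For every choice of $\{y_k\}$ and all $k\ge0$, $$y_k\in K(t_k,\varepsilon_k),\qquad (t_k,\varepsilon_k)\in\mathcal A,$$ $$\|T_{x_0}^{-1}[-F(y_k)]\|\le f(t_k)+\varepsilon_k\le\Big(\frac{1+\theta^2}{2}\Big)^k(f(t_0)+\varepsilon_0),$$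 $\{y_k\}$ is contained in $B(x_0,\lambda)$ and converges to a point $x_*\in B[x_0,\lambda]\cap\Omega$ such that $F(x_*)\in C$, and $$\|y_{k+1}-y_k\|\le t_{k+1}-t_k,\qquad\|x_*-y_k\|\le\tilde t-t_k,\qquad k=0,1,\dots.$$ Moreover, if $f(t)<0$ for some $t\in(0,R)$ and $\lambda<R$, then, $D^-$ denoting the left derivative, for $k=1,2,\dots$ $$\|y_k-y_{k+1}\|\le\frac{1+\theta}{1-\theta}\Big[\frac{1+\theta}{2}\,\frac{D^-f'(\lambda)}{|f'(\lambda)|}\|y_k-y_{k-1}\|+\theta\,\frac{2+f'(\lambda)}{|f'(\lambda)|}\Big]\|y_k-y_{k-1}\|.$$ If, additionally, $\theta<\big[-2(\kappa+1)+\sqrt{4(\kappa+1)^2+\kappa(4+\kappa)}\big]/(4+\kappa)$, then $\{y_k\}$ converges $Q$-linearly as follows (with $0/0:=0$): $$\limsup_{k\to\infty}\frac{\|x_*-y_{k+1}\|}{\|x_*-y_k\|}\le\frac{1+\theta}{1-\theta}\Big[\frac{1+\theta}{2}+\frac{2\theta}{\kappa}\Big]<1.$$ -/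

import Mathlib

open Set Filter Topology Metric
open scoped ENNReal

noncomputable section

namespace InexactNewton

/-! ### Set-valued maps, inner norms, the convex process of a cone inclusion -/

section Maps

variable {X Y Z : Type*} [NormedAddCommGroup X] [NormedSpace ℝ X]
  [NormedAddCommGroup Y] [NormedSpace ℝ Y] [NormedAddCommGroup Z]

/-- The distance of a set `S` to the origin, `inf {‖v‖ : v ∈ S}`, which is `+∞` if `S = ∅`. -/
def setNorm (S : Set Z) : ℝ≥0∞ := ⨅ v ∈ S, ‖v‖ₑ

/-- The (inner) norm of a set-valued map:
`sup {‖T d‖ : d ∈ dom T, ‖d‖ ≤ 1}` with `dom T = {d : T d ≠ ∅}`. -/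
def processNorm (T : X → Set Z) : ℝ≥0∞ :=
  ⨆ d ∈ {d : X | (T d).Nonempty ∧ ‖d‖ ≤ 1}, setNorm (T d)

/-- The convex process `T_z d = F'(z) d - C`. -/
def process (F : X → Y) (C : ConvexCone ℝ Y) (z : X) (d : X) : Set Y :=
  {y | ∃ c ∈ C, y = fderiv ℝ F z d - c}

/-- The inverse process `T_z⁻¹ y = {d : y ∈ T_z d}`. -/
def invProcess (F : X → Y) (C : ConvexCone ℝ Y) (z : X) (y : Y) : Set X :=
  {d | y ∈ process F C z d}

theorem mem_invProcess_iff (F : X → Y) (C : ConvexCone ℝ Y) (z : X) (y : Y) (d : X) :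
    d ∈ invProcess F C z y ↔ fderiv ℝ F z d - y ∈ C := by
  constructor
  · rintro ⟨c, hc, rfl⟩
    simpa using hc
  · intro h
    exact ⟨_, h, by simp⟩

/-- Robinson's condition at `x₀`: the range of `T_{x₀}` is the whole space `Y`. -/
def RobinsonCondition (F : X → Y) (C : ConvexCone ℝ Y) (x₀ : X) : Prop :=
  ∀ y : Y, ∃ d : X, y ∈ process F C x₀ d

end Maps

/-! ### The majorant function and its constants -/

/-- The derivative of `f : [0, R) → ℝ` (one-sided at `0`). -/
def mderiv (f : ℝ → ℝ) (R : ℝ) (t : ℝ) : ℝ := derivWithin f (Ico 0 R) t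

/-- The left derivative `D⁻ g (t)`. -/
def leftDeriv (g : ℝ → ℝ) (t : ℝ) : ℝ := derivWithin g (Iio t) t

/-- `κ = sup_{0 < t < R} -f(t) / t`. -/
def kappa (f : ℝ → ℝ) (R : ℝ) : ℝ := sSup ((fun t => -f t / t) '' Ioo 0 R)

/-- `λ = sup {t ∈ [0, R) : κ + f'(t) < 0}`. -/
def lam (f : ℝ → ℝ) (R : ℝ) : ℝ := sSup {t | t ∈ Ico 0 R ∧ kappa f R + mderiv f R t < 0}

/-- `θ̃ = κ / (2 - κ)`. -/
def thetaTilde (f : ℝ → ℝ) (R : ℝ) : ℝ := kappa f R / (2 - kappa f R)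

/-- `t̄ = sup {t ∈ [0, R) : f'(t) < 0}`. -/
def tbar (f : ℝ → ℝ) (R : ℝ) : ℝ := sSup {t | t ∈ Ico 0 R ∧ mderiv f R t < 0}

/-- The map `n_θ(t, ε) = (t - (1 + θ) (f(t) + ε) / f'(t), ε + 2 θ (f(t) + ε))`, to be used on
`[0, t̄) × [0, ∞)`. -/
def nMap (f : ℝ → ℝ) (R θ : ℝ) (p : ℝ × ℝ) : ℝ × ℝ :=
  (p.1 - (1 + θ) * ((f p.1 + p.2) / mderiv f R p.1), p.2 + 2 * θ * (f p.1 + p.2))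

/-- The set `𝒜 = {(t, ε) : 0 ≤ t < λ, 0 ≤ ε ≤ κ t, 0 < f(t) + ε}`. -/
def setA (f : ℝ → ℝ) (R : ℝ) : Set (ℝ × ℝ) :=
  {p | 0 ≤ p.1 ∧ p.1 < lam f R ∧ 0 ≤ p.2 ∧ p.2 ≤ kappa f R * p.1 ∧ 0 < f p.1 + p.2}

section Newton

variable {X Y : Type*} [NormedAddCommGroup X] [NormedSpace ℝ X]
  [NormedAddCommGroup Y] [NormedSpace ℝ Y]

/-- `f : [0, R) → ℝ` is a majorant function for `F : Ω → Y` (and the cone `C`) at `x₀`. -/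
structure IsMajorant (F : X → Y) (C : ConvexCone ℝ Y) (Ω : Set X) (x₀ : X) (R : ℝ)
    (f : ℝ → ℝ) : Prop where
  contDiffOn : ContDiffOn ℝ 1 f (Ico 0 R)
  ball_subset : ball x₀ R ⊆ Ω
  bound : ∀ x ∈ ball x₀ R, ∀ y ∈ ball x₀ R, ‖x - x₀‖ + ‖y - x‖ < R →
    (processNorm (fun d : X => invProcess F C x₀ ((fderiv ℝ F y - fderiv ℝ F x) d)) : EReal)
      ≤ ((mderiv f R (‖x - x₀‖ + ‖y - x‖) - mderiv f R ‖x - x₀‖ : ℝ) : EReal)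
  zero_pos : 0 < f 0
  deriv_zero : mderiv f R 0 = -1
  deriv_convex : ConvexOn ℝ (Ico 0 R) (mderiv f R)
  deriv_strictMono : StrictMonoOn (mderiv f R) (Ico 0 R)
  exists_root : ∃ t ∈ Ioo 0 R, f t = 0

/-- `K(t, ε) = {x : ‖x - x₀‖ ≤ t, ‖T_{x₀}⁻¹[-F(x)]‖ ≤ f(t) + ε}`. -/
def setK (F : X → Y) (C : ConvexCone ℝ Y) (x₀ : X) (f : ℝ → ℝ) (t ε : ℝ) : Set X :=
  {x | ‖x - x₀‖ ≤ t ∧ (setNorm (invProcess F C x₀ (-F x)) : EReal) ≤ ((f t + ε : ℝ) : EReal)}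

/-- The residuals allowed at `x`: those `r` with
`max_{w ∈ {-r, r}} ‖T_{x₀}⁻¹ w‖ ≤ θ ‖T_{x₀}⁻¹[-F(x)]‖`. -/
def residuals (F : X → Y) (C : ConvexCone ℝ Y) (x₀ : X) (θ : ℝ) (x : X) : Set Y :=
  {r | max (setNorm (invProcess F C x₀ (-r))) (setNorm (invProcess F C x₀ r))
    ≤ ENNReal.ofReal θ * setNorm (invProcess F C x₀ (-F x))}

/-- `argmin {‖d‖ : F(x) + F'(x) d + r ∈ C}`. -/
def stepSet (F : X → Y) (C : ConvexCone ℝ Y) (x : X) (r : Y) : Set X :=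
  {d | F x + fderiv ℝ F x d + r ∈ C ∧
    ∀ d' : X, F x + fderiv ℝ F x d' + r ∈ C → ‖d‖ ≤ ‖d'‖}

/-- The family `𝒩_θ` of inexact Newton iteration mappings on `B(x₀, t̄)`: at each point `x` a
nonempty set of allowed residuals is selected, and `N x = x + D` with `D` the set of all
corresponding minimal norm steps. The selection of a single residual `r(x)`, and that of all
allowed residuals, are both covered. The values outside `B(x₀, t̄)` are irrelevant. -/
def iterationFamily (F : X → Y) (C : ConvexCone ℝ Y) (x₀ : X) (f : ℝ → ℝ) (R θ : ℝ) :
    Set (X → Set X) :=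
  {N | ∀ x ∈ ball x₀ (tbar f R), ∃ S : Set Y, S.Nonempty ∧ S ⊆ residuals F C x₀ θ x ∧
    N x = {y | ∃ r ∈ S, y - x ∈ stepSet F C x r}}

end Newton

end InexactNewton

end

namespace InexactNewton

/-! All quantities are measured by one sublinear function on `Y`, `feasNorm`: the least norm of a
`d` with `F'(x₀) d - y ∈ C`. Reflexivity makes the minimum attained, Robinson's condition and
Baire's theorem bound it by `c * ‖y‖`, and it vanishes on `-C`, so elements of `C` cost nothing in
residual estimates.

Three facts reduce the method to a scalar iteration. A Neumann-type series
(`exists_feasible_perturb`) solves the inclusion for `F'(x)` at the cost of a factor `1 / -f'(‖x -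
x₀‖)`. Hahn–Banach (`exists_dual_feasNorm`) reduces the linearization error of `F` to real functions
on a segment, where the majorant condition bounds it by the linearization error of `f`. Convexity of
`f'` makes the latter grow with base point and step (`linError_mono`). Hence a step from `K(t, ε)`
lands in `K(n_θ(t, ε))` (`iteration_step`).

The scalar iteration rests on `tangent_lam_lt`: the tangent of `f` at any `t < λ` lies below the
line `-κ s` at `s = λ`. With `ε ≤ κ t` this gives `f(t) + ε < (-f'(t) - κ)(λ - t)`. Together with
`2θ ≤ κ(1 + θ)`, which is `θ ≤ θ̃`, this yields invariance of `𝒜` and the contraction factor `(1 +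
θ²)/2`. The steps of `y` are dominated by those of `t`, so `y` converges. The limit lies strictly
inside radius `R` even if `λ = R` (`lim_lt_of_nMap`), so closedness of `C` applies there.

For the rates, the steps are at most `(1 + θ)/κ` times the residuals, the residuals contract by `θ`
up to quadratic terms, and they are at most `2 - κ` times the distance to the limit, again up to
quadratic terms. The resulting ratio `(1 + θ)θ(2 - κ)/(κ(1 - θ))` is strictly below the claimed one.
-/

/-- The conditions on a majorant function that do not mention the operator. -/
structure ScalarMajorant (f : ℝ → ℝ) (R : ℝ) : Prop where
  contDiffOn : ContDiffOn ℝ 1 f (Ico 0 R)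
  zero_pos : 0 < f 0
  deriv_zero : mderiv f R 0 = -1
  deriv_convex : ConvexOn ℝ (Ico 0 R) (mderiv f R)
  deriv_strictMono : StrictMonoOn (mderiv f R) (Ico 0 R)
  exists_root : ∃ t ∈ Ioo 0 R, f t = 0

/-- A comparison principle: an inequality between derivatives can be integrated. -/
theorem sub_le_sub_of_hasDerivAt_le {u w u' w' : ℝ → ℝ} {a b : ℝ} (hab : a ≤ b)
    (hu : ContinuousOn u (Icc a b)) (hw : ContinuousOn w (Icc a b))
    (hu' : ∀ x ∈ Ioo a b, HasDerivAt u (u' x) x) (hw' : ∀ x ∈ Ioo a b, HasDerivAt w (w' x) x)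
    (hle : ∀ x ∈ Ioo a b, u' x ≤ w' x) : u b - u a ≤ w b - w a := by
  have hmono : MonotoneOn (fun x => w x - u x) (Icc a b) := by
    refine monotoneOn_of_deriv_nonneg (convex_Icc a b) (hw.sub hu) ?_ ?_
    · intro x hx
      rw [interior_Icc] at hx
      exact ((hw' x hx).sub (hu' x hx)).differentiableAt.differentiableWithinAt
    · intro x hx
      rw [interior_Icc] at hx
      have hd : HasDerivAt (fun x => w x - u x) (w' x - u' x) x := (hw' x hx).sub (hu' x hx)
      rw [hd.deriv]
      exact sub_nonneg.2 (hle x hx)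
  have := hmono (left_mem_Icc.2 hab) (right_mem_Icc.2 hab) hab
  simp only at this
  linarith

/-! ### The scalar majorant: `κ`, `λ`, tangents and linearization errors. -/

namespace ScalarMajorant

variable {f : ℝ → ℝ} {R : ℝ}

theorem R_pos (h : ScalarMajorant f R) : 0 < R := by
  obtain ⟨t, ht, -⟩ := h.exists_root
  exact ht.1.trans ht.2

theorem zero_mem (h : ScalarMajorant f R) : (0 : ℝ) ∈ Ico 0 R := ⟨le_rfl, h.R_pos⟩

theorem continuousOn (h : ScalarMajorant f R) : ContinuousOn f (Ico 0 R) :=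
  h.contDiffOn.continuousOn

theorem continuousOn_mderiv (h : ScalarMajorant f R) : ContinuousOn (mderiv f R) (Ico 0 R) :=
  h.contDiffOn.continuousOn_derivWithin (uniqueDiffOn_Ico 0 R) le_rfl

theorem hasDerivAt (h : ScalarMajorant f R) {t : ℝ} (ht : t ∈ Ioo 0 R) :
    HasDerivAt f (mderiv f R t) t := by
  have h1 : DifferentiableWithinAt ℝ f (Ico 0 R) t :=
    (h.contDiffOn.differentiableOn one_ne_zero) t (Ioo_subset_Ico_self ht)
  exact h1.hasDerivWithinAt.hasDerivAt (Ico_mem_nhds ht.1 ht.2)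

theorem mderiv_le (h : ScalarMajorant f R) {s t : ℝ} (hs : 0 ≤ s) (hst : s ≤ t) (ht : t < R) :
    mderiv f R s ≤ mderiv f R t :=
  h.deriv_strictMono.monotoneOn ⟨hs, hst.trans_lt ht⟩ ⟨hs.trans hst, ht⟩ hst

theorem tangent_lt (h : ScalarMajorant f R) {s t : ℝ} (ht : 0 ≤ t) (hts : t < s) (hs : s < R) :
    f t + mderiv f R t * (s - t) < f s := by
  obtain ⟨c, hc, hc'⟩ := exists_hasDerivAt_eq_slope f (mderiv f R) hts
    (h.continuousOn.mono fun x hx => ⟨ht.trans hx.1, hx.2.trans_lt hs⟩)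
    (fun x hx => h.hasDerivAt ⟨ht.trans_lt hx.1, hx.2.trans hs⟩)
  have hlt := h.deriv_strictMono ⟨ht, hts.trans hs⟩ ⟨ht.trans hc.1.le, hc.2.trans hs⟩ hc.1
  have hpos : 0 < s - t := sub_pos.2 hts
  rw [eq_div_iff hpos.ne'] at hc'
  nlinarith

/-- The tangent at `0` has slope `-1`, so `f t > f 0 - t`. The bound is uniform in `t` because `R`
is finite, which keeps `κ` strictly below `1`. -/
theorem quot_lt (h : ScalarMajorant f R) {t : ℝ} (ht : t ∈ Ioo 0 R) :
    -f t / t ≤ 1 - f 0 / R := by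
  have h1 := h.tangent_lt le_rfl ht.1 ht.2
  rw [h.deriv_zero] at h1
  have h2 : f 0 / R ≤ f 0 / t := div_le_div_of_nonneg_left h.zero_pos.le ht.1 ht.2.le
  have h3 : -f t / t ≤ (t - f 0) / t := div_le_div_of_nonneg_right (by linarith) ht.1.le
  have h4 : (t - f 0) / t = 1 - f 0 / t := by
    rw [sub_div, div_self ht.1.ne']
  linarith

theorem bddAbove_quot (h : ScalarMajorant f R) :
    BddAbove ((fun t => -f t / t) '' Ioo 0 R) := by
  refine ⟨1 - f 0 / R, ?_⟩
  rintro _ ⟨t, ht, rfl⟩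
  exact h.quot_lt ht

theorem nonempty_quot (h : ScalarMajorant f R) :
    ((fun t => -f t / t) '' Ioo 0 R).Nonempty := by
  obtain ⟨t, ht, -⟩ := h.exists_root
  exact ⟨_, t, ht, rfl⟩

theorem kappa_lt_one (h : ScalarMajorant f R) : kappa f R < 1 := by
  have h1 : kappa f R ≤ 1 - f 0 / R := by
    refine csSup_le h.nonempty_quot ?_
    rintro _ ⟨t, ht, rfl⟩
    exact h.quot_lt ht
  have := div_pos h.zero_pos h.R_pos
  linarith

theorem kappa_nonneg (h : ScalarMajorant f R) : 0 ≤ kappa f R := by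
  obtain ⟨t, ht, ht0⟩ := h.exists_root
  exact le_csSup h.bddAbove_quot ⟨t, ht, by simp [ht0]⟩

theorem add_kappa_nonneg (h : ScalarMajorant f R) {t : ℝ} (ht : t ∈ Ico 0 R) :
    0 ≤ f t + kappa f R * t := by
  rcases ht.1.eq_or_lt with h0 | h0
  · rw [← h0]
    simpa using h.zero_pos.le
  · have : -f t / t ≤ kappa f R := le_csSup h.bddAbove_quot ⟨t, ⟨h0, ht.2⟩, rfl⟩
    rw [div_le_iff₀ h0] at this
    linarith

theorem exists_add_kappa_lt (h : ScalarMajorant f R) {η : ℝ} (hη : 0 < η) :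
    ∃ t ∈ Ioo 0 R, f t + kappa f R * t < η := by
  have hR := h.R_pos
  obtain ⟨_, ⟨t, ht, rfl⟩, hlt⟩ := exists_lt_of_lt_csSup h.nonempty_quot
    (show kappa f R - η / R < sSup _ from sub_lt_self _ (div_pos hη hR))
  refine ⟨t, ht, ?_⟩
  simp only at hlt
  rw [lt_div_iff₀ ht.1, sub_mul] at hlt
  have : η / R * t ≤ η := by
    rw [div_mul_eq_mul_div, div_le_iff₀ hR]
    nlinarith [ht.2]
  linarith

theorem kappa_pos (h : ScalarMajorant f R) (hneg : ∃ s ∈ Ioo 0 R, f s < 0) : 0 < kappa f R := by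
  obtain ⟨s, hs, hs0⟩ := hneg
  have := h.add_kappa_nonneg (Ioo_subset_Ico_self hs)
  have h1 : 0 < kappa f R * s := by linarith
  exact pos_of_mul_pos_left h1 hs.1.le

theorem bddAbove_lam (f : ℝ → ℝ) (R : ℝ) :
    BddAbove {t | t ∈ Ico 0 R ∧ kappa f R + mderiv f R t < 0} :=
  ⟨R, fun _ ht => ht.1.2.le⟩

theorem zero_mem_lam (h : ScalarMajorant f R) :
    (0 : ℝ) ∈ {t | t ∈ Ico 0 R ∧ kappa f R + mderiv f R t < 0} := by
  refine ⟨h.zero_mem, ?_⟩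
  rw [h.deriv_zero]
  linarith [h.kappa_lt_one]

theorem lam_le (h : ScalarMajorant f R) : lam f R ≤ R :=
  csSup_le ⟨0, h.zero_mem_lam⟩ fun _ ht => ht.1.2.le

theorem lam_le_tbar (h : ScalarMajorant f R) : lam f R ≤ tbar f R := by
  refine csSup_le_csSup ⟨R, fun _ ht => ht.1.2.le⟩ ⟨0, h.zero_mem_lam⟩ fun t ht => ⟨ht.1, ?_⟩
  linarith [ht.2, h.kappa_nonneg]

theorem tbar_le (h : ScalarMajorant f R) : tbar f R ≤ R := by
  refine csSup_le ⟨0, h.zero_mem, ?_⟩ fun _ ht => ht.1.2.le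
  rw [h.deriv_zero]
  norm_num

theorem mderiv_lt (h : ScalarMajorant f R) {t : ℝ} (ht : 0 ≤ t) (htl : t < lam f R) :
    mderiv f R t < -kappa f R := by
  obtain ⟨s, hs, hts⟩ := exists_lt_of_lt_csSup ⟨0, h.zero_mem_lam⟩ htl
  have := h.mderiv_le ht hts.le hs.1.2
  linarith [hs.2]

theorem mderiv_neg_of_lt_tbar (h : ScalarMajorant f R) {t : ℝ} (ht : 0 ≤ t)
    (htl : t < tbar f R) : mderiv f R t < 0 := by
  have hne : {t | t ∈ Ico 0 R ∧ mderiv f R t < 0}.Nonempty :=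
    ⟨0, h.zero_mem, by rw [h.deriv_zero]; norm_num⟩
  obtain ⟨s, hs, hts⟩ := exists_lt_of_lt_csSup hne htl
  exact (h.mderiv_le ht hts.le hs.1.2).trans_lt hs.2

theorem le_mderiv {t : ℝ} (ht : t ∈ Ico 0 R) (htl : lam f R < t) :
    -kappa f R ≤ mderiv f R t := by
  by_contra! hc
  exact htl.not_ge (le_csSup (bddAbove_lam f R) ⟨ht, by linarith⟩)

theorem lam_pos (h : ScalarMajorant f R) : 0 < lam f R := by
  have hR := h.R_pos
  by_contra! hl
  have hc : Tendsto (mderiv f R) (𝓝[Ioo 0 R] 0) (𝓝 (mderiv f R 0)) :=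
    (h.continuousOn_mderiv 0 h.zero_mem).mono Ioo_subset_Ico_self
  have : (𝓝[Ioo 0 R] (0 : ℝ)).NeBot := by
    rw [nhdsWithin_Ioo_eq_nhdsGT hR]
    infer_instance
  have h1 : -kappa f R ≤ mderiv f R 0 := by
    refine ge_of_tendsto hc ?_
    filter_upwards [self_mem_nhdsWithin] with t ht
    exact le_mderiv (Ioo_subset_Ico_self ht) (hl.trans_lt ht.1)
  rw [h.deriv_zero] at h1
  linarith [h.kappa_lt_one]

theorem mderiv_lam (h : ScalarMajorant f R) (hl : lam f R < R) :
    mderiv f R (lam f R) = -kappa f R := by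
  have hc : ContinuousAt (mderiv f R) (lam f R) :=
    (h.continuousOn_mderiv _ ⟨h.lam_pos.le, hl⟩).continuousAt (Ico_mem_nhds h.lam_pos hl)
  refine le_antisymm ?_ ?_
  · refine le_of_tendsto (hc.mono_left (nhdsWithin_le_nhds (s := Iio (lam f R)))) ?_
    filter_upwards [Ioo_mem_nhdsLT h.lam_pos] with t ht
    exact (h.mderiv_lt ht.1.le ht.2).le
  · refine ge_of_tendsto (hc.mono_left (nhdsWithin_le_nhds (s := Ioi (lam f R)))) ?_
    filter_upwards [Ioo_mem_nhdsGT hl] with t ht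
    exact le_mderiv ⟨h.lam_pos.le.trans ht.1.le, ht.2⟩ ht.1

theorem add_kappa_antitone (h : ScalarMajorant f R) {s t : ℝ} (hs : 0 ≤ s) (hst : s ≤ t)
    (ht : t < lam f R) : f t + kappa f R * t ≤ f s + kappa f R * s := by
  have htR := ht.trans_le h.lam_le
  have := sub_le_sub_of_hasDerivAt_le (u := f) (w := fun x => -kappa f R * x)
    (u' := mderiv f R) (w' := fun _ => -kappa f R) hst
    (h.continuousOn.mono fun x hx => ⟨hs.trans hx.1, hx.2.trans_lt htR⟩) (by fun_prop)
    (fun x hx => h.hasDerivAt ⟨hs.trans_lt hx.1, hx.2.trans htR⟩)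
    (fun x _ => by simpa using (hasDerivAt_id x).const_mul (-kappa f R))
    (fun x hx => (h.mderiv_lt (hs.trans hx.1.le) (hx.2.trans ht)).le)
  linarith

theorem add_kappa_monotone (h : ScalarMajorant f R) {t : ℝ} (hlt : lam f R ≤ t) (ht : t < R) :
    f (lam f R) + kappa f R * lam f R ≤ f t + kappa f R * t := by
  have hl := h.lam_pos
  have := sub_le_sub_of_hasDerivAt_le (w := f) (u := fun x => -kappa f R * x)
    (w' := mderiv f R) (u' := fun _ => -kappa f R) hlt (by fun_prop)
    (h.continuousOn.mono fun x hx => ⟨hl.le.trans hx.1, hx.2.trans_lt ht⟩)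
    (fun x _ => by simpa using (hasDerivAt_id x).const_mul (-kappa f R))
    (fun x hx => h.hasDerivAt ⟨hl.trans hx.1, hx.2.trans ht⟩)
    (fun x hx => le_mderiv ⟨hl.le.trans hx.1.le, hx.2.trans ht⟩ hx.1)
  linarith

/-- The function `s ↦ f s + κ s` is nonincreasing before `λ` and nondecreasing after it, so its
infimum `0` is approached from the left at `λ`. -/
theorem exists_add_kappa_lt_near (h : ScalarMajorant f R) {t η : ℝ}
    (ht : t < lam f R) (hη : 0 < η) :
    ∃ s ∈ Ioo t (lam f R), f s + kappa f R * s < η := by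
  obtain ⟨t', ht', hlt⟩ := h.exists_add_kappa_lt hη
  rcases lt_or_ge t' (lam f R) with hc | hc
  · obtain ⟨s, hs⟩ := exists_between (max_lt ht hc)
    exact ⟨s, ⟨(le_max_left _ _).trans_lt hs.1, hs.2⟩,
      (h.add_kappa_antitone ht'.1.le ((le_max_right _ _).trans hs.1.le) hs.2).trans_lt hlt⟩
  · have hlR : lam f R < R := hc.trans_lt ht'.2
    have h1 := (h.add_kappa_monotone hc ht'.2).trans_lt hlt
    have hcont : ContinuousAt (fun s => f s + kappa f R * s) (lam f R) :=
      ((h.hasDerivAt ⟨h.lam_pos, hlR⟩).continuousAt).add (by fun_prop)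
    have h2 : ∀ᶠ s in 𝓝[<] (lam f R), f s + kappa f R * s < η :=
      (hcont.eventually_lt_const h1).filter_mono nhdsWithin_le_nhds
    obtain ⟨s, hs1, hs2⟩ := (h2.and (Ioo_mem_nhdsLT ht)).exists
    exact ⟨s, hs2, hs1⟩

/-- The tangents of `f` cross the line `s ↦ -κ s` before `λ`. -/
theorem tangent_lam_lt (h : ScalarMajorant f R) {t : ℝ} (ht0 : 0 ≤ t) (ht : t < lam f R) :
    f t + mderiv f R t * (lam f R - t) < -kappa f R * lam f R := by
  by_contra! hc
  -- If `λ = R`, nothing is known about `f` at `λ`, so strictness is gained at an intermediate `m`.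
  -- The tangent at `m` exceeds `-κ s` at `λ` by a positive gap, and then `f s + κ s` exceeds this
  -- gap for all `s` in `(m, λ)`, contradicting `exists_add_kappa_lt_near`.
  obtain ⟨m, hm⟩ := exists_between ht
  have hmR := hm.2.trans_le h.lam_le
  have h1 := h.tangent_lt ht0 hm.1 hmR
  have h2 := h.deriv_strictMono ⟨ht0, ht.trans_le h.lam_le⟩ ⟨ht0.trans hm.1.le, hmR⟩ hm.1
  have h3 : mderiv f R t * (lam f R - m) < mderiv f R m * (lam f R - m) :=
    mul_lt_mul_of_pos_right h2 (sub_pos.2 hm.2)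
  have hpos : 0 < f m + mderiv f R m * (lam f R - m) + kappa f R * lam f R := by nlinarith
  obtain ⟨s, hs, hs'⟩ := h.exists_add_kappa_lt_near hm.2 hpos
  have h4 := h.tangent_lt (ht0.trans hm.1.le) hs.1 (hs.2.trans_le h.lam_le)
  have h5 := h.mderiv_lt (ht0.trans hm.1.le) hm.2
  have h6 : (mderiv f R m + kappa f R) * (lam f R - s) ≤ 0 :=
    mul_nonpos_of_nonpos_of_nonneg (by linarith) (sub_pos.2 hs.2).le
  nlinarith

theorem mderiv_sub_mul_le (h : ScalarMajorant f R) {r s t : ℝ} (hr : 0 ≤ r) (hrs : r ≤ s)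
    (hst : s ≤ t) (ht : t < R) :
    (mderiv f R s - mderiv f R r) * (t - r) ≤ (s - r) * (mderiv f R t - mderiv f R r) := by
  rcases hrs.eq_or_lt with rfl | hrs
  · simp
  rcases hst.eq_or_lt with rfl | hst
  · linarith
  have := h.deriv_convex.secant_mono_aux2 (⟨hr, (hrs.trans hst).trans ht⟩)
    ⟨(hr.trans hrs.le).trans hst.le, ht⟩ hrs hst
  rw [div_le_div_iff₀ (sub_pos.2 hrs) (sub_pos.2 (hrs.trans hst))] at this
  linarith

/-- The chord inequality with right endpoint tending to `λ` from below. Only `f' < -κ` to the left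
of `λ` enters, so `λ = R` is allowed. -/
theorem mderiv_sub_mul_le_lam (h : ScalarMajorant f R) {s t : ℝ} (ht : 0 ≤ t) (hts : t ≤ s)
    (hs : s < lam f R) :
    (mderiv f R s - mderiv f R t) * (lam f R - t) ≤ (s - t) * (-kappa f R - mderiv f R t) := by
  have hc : Tendsto (fun x => (mderiv f R s - mderiv f R t) * (x - t)) (𝓝[<] (lam f R))
      (𝓝 ((mderiv f R s - mderiv f R t) * (lam f R - t))) := by
    refine Tendsto.mono_left ?_ nhdsWithin_le_nhds
    exact (Continuous.tendsto (by fun_prop) _)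
  refine le_of_tendsto hc ?_
  filter_upwards [Ioo_mem_nhdsLT hs] with x hx
  refine (h.mderiv_sub_mul_le ht hts hx.1.le (hx.2.trans_le h.lam_le)).trans ?_
  have := h.mderiv_lt ((ht.trans hts).trans hx.1.le) hx.2
  exact mul_le_mul_of_nonneg_left (by linarith) (sub_nonneg.2 hts)

theorem continuousOn_shift (h : ScalarMajorant f R) {t b : ℝ} (ht : 0 ≤ t) (hR : t + b < R) :
    ContinuousOn (fun x => f (t + x)) (Icc 0 b) := by
  refine h.continuousOn.comp (by fun_prop) fun x hx => ?_
  exact ⟨by linarith [hx.1], by linarith [hx.2]⟩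

theorem hasDerivAt_shift (h : ScalarMajorant f R) {t b : ℝ} (ht : 0 ≤ t) (hR : t + b < R)
    {x : ℝ} (hx : x ∈ Ioo 0 b) : HasDerivAt (fun x => f (t + x)) (mderiv f R (t + x)) x := by
  have := h.hasDerivAt (t := t + x) ⟨by linarith [hx.1], by linarith [hx.2]⟩
  exact this.comp_const_add t x

/-- The error of the linearization of `f` at `t`, evaluated at `t + b`. -/
theorem linError_le_sq (h : ScalarMajorant f R) {t b L : ℝ} (ht : 0 ≤ t) (hb : 0 ≤ b)
    (hR : t + b < R)
    (hL : ∀ x ∈ Ioo 0 b, mderiv f R (t + x) - mderiv f R t ≤ L * x) :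
    f (t + b) - f t - mderiv f R t * b ≤ L * b ^ 2 / 2 := by
  have := sub_le_sub_of_hasDerivAt_le (u := fun x => f (t + x))
    (w := fun x => mderiv f R t * x + L * x ^ 2 / 2) (u' := fun x => mderiv f R (t + x))
    (w' := fun x => mderiv f R t + L * x) hb (h.continuousOn_shift ht hR) (by fun_prop)
    (fun x hx => h.hasDerivAt_shift ht hR hx)
    (fun x _ => by
      have := ((hasDerivAt_id' x).const_mul (mderiv f R t)).add
        (((hasDerivAt_pow 2 x).const_mul L).div_const 2)
      refine this.congr_deriv ?_
      push_cast
      ring)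
    (fun x hx => by linarith [hL x hx])
  simp only [add_zero] at this
  linarith

/-- Monotonicity in the step comes from `f'` increasing, in the base point from convexity of `f'`:
increments over a fixed length grow. -/
theorem linError_mono (h : ScalarMajorant f R) {s t a b : ℝ} (hs : 0 ≤ s) (hst : s ≤ t)
    (ha : 0 ≤ a) (hab : a ≤ b) (hR : t + b < R) :
    f (s + a) - f s - mderiv f R s * a ≤ f (t + b) - f t - mderiv f R t * b := by
  have ht := hs.trans hst
  have h1 : f (s + a) - f s - mderiv f R s * a ≤ f (s + b) - f s - mderiv f R s * b := by
    have hsb : s + b < R := by linarith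
    have := sub_le_sub_of_hasDerivAt_le (u := fun x => mderiv f R s * x) (w := f)
      (u' := fun _ => mderiv f R s) (w' := mderiv f R) (a := s + a) (b := s + b)
      (by linarith) (by fun_prop)
      (h.continuousOn.mono fun x hx => ⟨by linarith [hx.1], by linarith [hx.2]⟩)
      (fun x _ => by simpa using (hasDerivAt_id x).const_mul (mderiv f R s))
      (fun x hx => h.hasDerivAt ⟨by linarith [hx.1], by linarith [hx.2]⟩)
      (fun x hx => h.mderiv_le hs (by linarith [hx.1]) (by linarith [hx.2]))
    linarith
  have hb := ha.trans hab
  have h2 := sub_le_sub_of_hasDerivAt_le (u := fun x => f (s + x) - mderiv f R s * x)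
      (w := fun x => f (t + x) - mderiv f R t * x)
      (u' := fun x => mderiv f R (s + x) - mderiv f R s)
      (w' := fun x => mderiv f R (t + x) - mderiv f R t) hb
      ((h.continuousOn_shift hs (by linarith)).sub (by fun_prop))
      ((h.continuousOn_shift ht hR).sub (by fun_prop))
      (fun x hx => (h.hasDerivAt_shift hs (by linarith) hx).sub
        (by simpa using (hasDerivAt_id x).const_mul (mderiv f R s)))
      (fun x hx => (h.hasDerivAt_shift ht hR hx).sub
        (by simpa using (hasDerivAt_id x).const_mul (mderiv f R t)))
      (fun x hx => by
        rcases hst.eq_or_lt with rfl | hst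
        · exact le_rfl
        have hx1 := hx.1
        have hx2 := hx.2
        -- Chord bounds over `[s, t + x]` at the points `s + x` and `t`: their weights add up to
        -- `1`.
        have e1 := h.mderiv_sub_mul_le hs (show s ≤ s + x by linarith)
          (show s + x ≤ t + x by linarith) (by linarith)
        have e2 := h.mderiv_sub_mul_le hs (show s ≤ t by linarith)
          (show t ≤ t + x by linarith) (by linarith)
        have e3 : 0 < t + x - s := by linarith
        nlinarith)
  simp only [add_zero, mul_zero, sub_zero] at h2
  linarith

variable {θ : ℝ}

/-- Slopes of the convex `f'` increase, so its left derivative at `λ` is a Lipschitz constant on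
`[0, λ]`. -/
theorem mderiv_sub_le_leftDeriv (h : ScalarMajorant f R) (hl : lam f R < R) {s t : ℝ}
    (hs : 0 ≤ s) (hst : s ≤ t) (ht : t ≤ lam f R) :
    mderiv f R t - mderiv f R s ≤ leftDeriv (mderiv f R) (lam f R) * (t - s) := by
  rcases hst.eq_or_lt with rfl | hst
  · simp
  have hsl := hst.trans_le ht
  have h1 : slope (mderiv f R) s (lam f R) ≤ leftDeriv (mderiv f R) (lam f R) := by
    refine h.deriv_convex.slope_le_leftDeriv_of_mem_interior ⟨hs, hsl.trans hl⟩ ?_ hsl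
    rw [interior_Ico]
    exact ⟨h.lam_pos, hl⟩
  rw [slope_def_field, div_le_iff₀ (sub_pos.2 hsl)] at h1
  have h2 := h.mderiv_sub_mul_le hs hst.le ht hl
  have h3 : 0 < lam f R - s := sub_pos.2 hsl
  have h4 : 0 < t - s := sub_pos.2 hst
  refine le_of_mul_le_mul_right (h2.trans ?_) h3
  nlinarith

theorem leftDeriv_nonneg (h : ScalarMajorant f R) (hl : lam f R < R) :
    0 ≤ leftDeriv (mderiv f R) (lam f R) := by
  have h1 := h.mderiv_sub_le_leftDeriv hl le_rfl h.lam_pos.le le_rfl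
  have h2 := h.mderiv_le le_rfl h.lam_pos.le hl
  have h3 : 0 ≤ leftDeriv (mderiv f R) (lam f R) * (lam f R - 0) := by linarith
  rw [sub_zero] at h3
  exact nonneg_of_mul_nonneg_left h3 h.lam_pos

/-! ### The scalar iteration `n_θ` on `𝒜`. -/

theorem two_mul_theta_le (h : ScalarMajorant f R) (hθ : θ ≤ thetaTilde f R) :
    2 * θ ≤ kappa f R * (1 + θ) := by
  have h1 := h.kappa_lt_one
  rw [thetaTilde, le_div_iff₀ (by linarith)] at hθ
  linarith

theorem theta_lt_one (h : ScalarMajorant f R) (hθ : θ ≤ thetaTilde f R) : θ < 1 := by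
  have h1 := h.kappa_lt_one
  have h2 : thetaTilde f R < 1 := by
    rw [thetaTilde, div_lt_one (by linarith)]
    linarith
  linarith

theorem neg_one_le_mderiv (h : ScalarMajorant f R) {t : ℝ} (ht : t ∈ Ico 0 R) :
    -1 ≤ mderiv f R t := by
  rw [← h.deriv_zero]
  exact h.mderiv_le le_rfl ht.1 ht.2

theorem mderiv_mul_step (h : ScalarMajorant f R) {p : ℝ × ℝ} (hp : p ∈ setA f R) :
    -mderiv f R p.1 * ((nMap f R θ p).1 - p.1) = (1 + θ) * (f p.1 + p.2) := by
  have h1 := h.mderiv_lt hp.1 hp.2.1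
  have h2 : mderiv f R p.1 ≠ 0 := by linarith [h.kappa_nonneg]
  simp only [nMap]
  field_simp
  ring

theorem lt_nMap_fst (h : ScalarMajorant f R) (hθ0 : 0 ≤ θ) {p : ℝ × ℝ} (hp : p ∈ setA f R) :
    p.1 < (nMap f R θ p).1 := by
  have h1 := h.mderiv_lt hp.1 hp.2.1
  have h2 := h.mderiv_mul_step (θ := θ) hp
  have h3 : 0 < (1 + θ) * (f p.1 + p.2) := mul_pos (by linarith) hp.2.2.2.2
  rw [← h2] at h3
  exact sub_pos.1 (pos_of_mul_pos_right h3 (by linarith [h.kappa_nonneg]))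

theorem le_nMap_snd (hθ0 : 0 ≤ θ) {p : ℝ × ℝ} (hp : p ∈ setA f R) :
    p.2 ≤ (nMap f R θ p).2 := by
  have := mul_nonneg (mul_nonneg zero_le_two hθ0) hp.2.2.2.2.le
  simp only [nMap]
  linarith

theorem nMap_snd_sub_le (h : ScalarMajorant f R) (hθ : θ ≤ thetaTilde f R)
    {p : ℝ × ℝ} (hp : p ∈ setA f R) :
    (nMap f R θ p).2 - p.2 ≤ kappa f R * -mderiv f R p.1 * ((nMap f R θ p).1 - p.1) := by
  have h2 := h.mderiv_mul_step (θ := θ) hp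
  have h3 := mul_le_mul_of_nonneg_right (h.two_mul_theta_le hθ) hp.2.2.2.2.le
  rw [mul_assoc, h2]
  simp only [nMap]
  linarith

/-- The tangent estimate at `λ` combined with `ε ≤ κ t`; both `nMap_fst_lt` and `add_nMap_le` rest
on it. -/
theorem add_lt_of_mem_setA (h : ScalarMajorant f R) {p : ℝ × ℝ} (hp : p ∈ setA f R) :
    f p.1 + p.2 < (-mderiv f R p.1 - kappa f R) * (lam f R - p.1) := by
  have h1 := h.tangent_lam_lt hp.1 hp.2.1
  have h2 := hp.2.2.2.1
  linarith

theorem nMap_fst_lt (h : ScalarMajorant f R) (hθ0 : 0 ≤ θ) (hθ : θ ≤ thetaTilde f R)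
    {p : ℝ × ℝ} (hp : p ∈ setA f R) : (nMap f R θ p).1 < lam f R := by
  have hκ := h.kappa_nonneg
  have hκ1 := h.kappa_lt_one
  have h1 := h.mderiv_lt hp.1 hp.2.1
  have h0 := h.neg_one_le_mderiv ⟨hp.1, hp.2.1.trans_le h.lam_le⟩
  have h2 := h.mderiv_mul_step (θ := θ) hp
  have h3 := h.add_lt_of_mem_setA hp
  have h4 := h.two_mul_theta_le hθ
  set a := -mderiv f R p.1 with ha
  have hΔ : 0 < lam f R - p.1 := sub_pos.2 hp.2.1
  -- Equivalent to `θ a ≤ κ (1 + θ)`, which follows from `a ≤ 1` and `2θ ≤ κ (1 + θ)`.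
  have h5 : (1 + θ) * (a - kappa f R) ≤ a := by
    have h6 : 0 ≤ 1 - θ := by linarith [h.theta_lt_one hθ]
    nlinarith [mul_nonneg hκ (show 0 ≤ 1 - a by linarith),
      mul_nonneg (mul_nonneg hκ (show 0 ≤ 1 - a by linarith)) hθ0]
  have h6 : a * ((nMap f R θ p).1 - p.1) < a * (lam f R - p.1) := by
    rw [h2]
    calc (1 + θ) * (f p.1 + p.2)
        < (1 + θ) * ((a - kappa f R) * (lam f R - p.1)) :=
          mul_lt_mul_of_pos_left h3 (by linarith)
      _ = ((1 + θ) * (a - kappa f R)) * (lam f R - p.1) := by ring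
      _ ≤ a * (lam f R - p.1) := mul_le_mul_of_nonneg_right h5 hΔ.le
  have := lt_of_mul_lt_mul_left h6 (by linarith)
  linarith

/-- The Newton step removes `(1 + θ)(f + ε)` and the second component returns `2θ(f + ε)`, leaving
`θ(f + ε)`. This mirrors the residual recursion `feasNorm_next_le`. -/
theorem add_nMap_eq (h : ScalarMajorant f R) {p : ℝ × ℝ} (hp : p ∈ setA f R) :
    f (nMap f R θ p).1 + (nMap f R θ p).2 = θ * (f p.1 + p.2) +
      (f (nMap f R θ p).1 - f p.1 - mderiv f R p.1 * ((nMap f R θ p).1 - p.1)) := by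
  have h2 := h.mderiv_mul_step (θ := θ) hp
  have h3 : (nMap f R θ p).2 = p.2 + 2 * θ * (f p.1 + p.2) := rfl
  rw [h3]
  linarith

theorem nMap_mem_setA (h : ScalarMajorant f R) (hθ0 : 0 ≤ θ) (hθ : θ ≤ thetaTilde f R)
    {p : ℝ × ℝ} (hp : p ∈ setA f R) : nMap f R θ p ∈ setA f R := by
  have h1 := h.nMap_fst_lt hθ0 hθ hp
  have h2 := h.lt_nMap_fst hθ0 hp
  refine ⟨hp.1.trans h2.le, h1, hp.2.2.1.trans (le_nMap_snd hθ0 hp), ?_, ?_⟩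
  · have h3 := h.nMap_snd_sub_le hθ hp
    have h4 := h.neg_one_le_mderiv ⟨hp.1, hp.2.1.trans_le h.lam_le⟩
    have h5 : kappa f R * -mderiv f R p.1 * ((nMap f R θ p).1 - p.1)
        ≤ kappa f R * 1 * ((nMap f R θ p).1 - p.1) :=
      mul_le_mul_of_nonneg_right
        (mul_le_mul_of_nonneg_left (by linarith) h.kappa_nonneg) (sub_pos.2 h2).le
    linarith [hp.2.2.2.1]
  · rw [h.add_nMap_eq hp]
    have h3 := h.tangent_lt hp.1 h2 (h1.trans_le h.lam_le)
    have h4 := mul_nonneg hθ0 hp.2.2.2.2.le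
    linarith

theorem add_nMap_le (h : ScalarMajorant f R) (hθ0 : 0 ≤ θ) (hθ : θ ≤ thetaTilde f R)
    {p : ℝ × ℝ} (hp : p ∈ setA f R) :
    f (nMap f R θ p).1 + (nMap f R θ p).2 ≤ (1 + θ ^ 2) / 2 * (f p.1 + p.2) := by
  have hκ := h.kappa_nonneg
  have hlt := h.nMap_fst_lt hθ0 hθ hp
  have hpos := h.lt_nMap_fst hθ0 hp
  have h1 := h.mderiv_lt hp.1 hp.2.1
  have h0 := h.neg_one_le_mderiv ⟨hp.1, hp.2.1.trans_le h.lam_le⟩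
  have h2 := h.mderiv_mul_step (θ := θ) hp
  have h3 := h.add_lt_of_mem_setA hp
  have h4 := h.two_mul_theta_le hθ
  have hθ1 := h.theta_lt_one hθ
  have hΔ : 0 < lam f R - p.1 := sub_pos.2 hp.2.1
  have hD := hp.2.2.2.2
  rw [h.add_nMap_eq hp]
  set b := (nMap f R θ p).1 - p.1 with hb
  have hb' : (nMap f R θ p).1 = p.1 + b := by rw [hb]; ring
  rw [hb'] at hlt ⊢
  have hb0 : 0 < b := sub_pos.2 hpos
  set a := -mderiv f R p.1 with ha
  set D := f p.1 + p.2 with hDdef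
  have ha0 : 0 < a := by linarith
  -- `L` is the slope of the line joining the value `f'(t)` at `t` to the value `-κ` at `λ`.
  have herr := h.linError_le_sq (L := (a - kappa f R) / (lam f R - p.1)) hp.1 hb0.le
    (hlt.trans_le h.lam_le) (fun x hx => by
      have := h.mderiv_sub_mul_le_lam hp.1 (show p.1 ≤ p.1 + x by linarith [hx.1])
        (by linarith [hx.2])
      rw [div_mul_eq_mul_div, le_div_iff₀ hΔ]
      refine this.trans (le_of_eq ?_)
      rw [ha]
      ring)
  -- the quadratic error is controlled because `D < (a - κ) (λ - t)`
  have hkey : (a - kappa f R) / (lam f R - p.1) * b ^ 2 / 2 ≤ (1 - θ) ^ 2 / 2 * D := by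
    -- Equivalent to `2θ a ≤ κ (1 + θ)`.
    have e1 : (1 + θ) * (a - kappa f R) ≤ a * (1 - θ) := by
      nlinarith [mul_nonneg hκ (show 0 ≤ 1 - a by linarith),
        mul_nonneg (mul_nonneg hκ (show 0 ≤ 1 - a by linarith)) hθ0]
    have e2 : 0 ≤ (1 + θ) * (a - kappa f R) := mul_nonneg (by linarith) (by linarith)
    have e3 : ((1 + θ) * (a - kappa f R)) ^ 2 ≤ (a * (1 - θ)) ^ 2 := pow_le_pow_left₀ e2 e1 2
    rw [div_mul_eq_mul_div, div_div, div_le_iff₀ (by linarith)]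
    have e4 : (a - kappa f R) * (a * b) ^ 2
        ≤ a ^ 2 * ((1 - θ) ^ 2 * D * (lam f R - p.1)) := by
      rw [h2]
      have e5 : (a - kappa f R) * D ≤ (a - kappa f R) * ((a - kappa f R) * (lam f R - p.1)) :=
        mul_le_mul_of_nonneg_left h3.le (by linarith)
      calc (a - kappa f R) * ((1 + θ) * D) ^ 2
          = ((1 + θ) ^ 2 * D) * ((a - kappa f R) * D) := by ring
        _ ≤ ((1 + θ) ^ 2 * D) * ((a - kappa f R) * ((a - kappa f R) * (lam f R - p.1))) :=
            mul_le_mul_of_nonneg_left e5 (by positivity)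
        _ = ((1 + θ) * (a - kappa f R)) ^ 2 * (D * (lam f R - p.1)) := by ring
        _ ≤ (a * (1 - θ)) ^ 2 * (D * (lam f R - p.1)) :=
            mul_le_mul_of_nonneg_right e3 (by positivity)
        _ = _ := by ring
    have e6 : a ^ 2 * ((a - kappa f R) * b ^ 2)
        ≤ a ^ 2 * ((1 - θ) ^ 2 * D * (lam f R - p.1)) := by
      refine le_trans (le_of_eq ?_) e4
      ring
    have := le_of_mul_le_mul_left e6 (by positivity)
    linarith
  -- `θ + (1 - θ)² / 2 = (1 + θ²) / 2`.
  nlinarith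

variable {t ε : ℕ → ℝ}

theorem mem_setA_of_nMap (h : ScalarMajorant f R) (hθ0 : 0 ≤ θ) (hθ : θ ≤ thetaTilde f R)
    (hA : (t 0, ε 0) ∈ setA f R) (htε : ∀ k, (t (k + 1), ε (k + 1)) = nMap f R θ (t k, ε k))
    (k : ℕ) : (t k, ε k) ∈ setA f R := by
  induction k with
  | zero => exact hA
  | succ k ih =>
    rw [htε]
    exact h.nMap_mem_setA hθ0 hθ ih

theorem strictMono_of_nMap (h : ScalarMajorant f R) (hθ0 : 0 ≤ θ) (hθ : θ ≤ thetaTilde f R)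
    (hA : (t 0, ε 0) ∈ setA f R) (htε : ∀ k, (t (k + 1), ε (k + 1)) = nMap f R θ (t k, ε k)) :
    StrictMono t := by
  refine strictMono_nat_of_lt_succ fun k => ?_
  have := h.lt_nMap_fst hθ0 (h.mem_setA_of_nMap hθ0 hθ hA htε k)
  rwa [← htε] at this

theorem monotone_of_nMap (h : ScalarMajorant f R) (hθ0 : 0 ≤ θ) (hθ : θ ≤ thetaTilde f R)
    (hA : (t 0, ε 0) ∈ setA f R) (htε : ∀ k, (t (k + 1), ε (k + 1)) = nMap f R θ (t k, ε k)) :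
    Monotone ε := by
  refine monotone_nat_of_le_succ fun k => ?_
  have := le_nMap_snd hθ0 (h.mem_setA_of_nMap hθ0 hθ hA htε k)
  rwa [← htε] at this

theorem add_le_pow_of_nMap (h : ScalarMajorant f R) (hθ0 : 0 ≤ θ) (hθ : θ ≤ thetaTilde f R)
    (hA : (t 0, ε 0) ∈ setA f R) (htε : ∀ k, (t (k + 1), ε (k + 1)) = nMap f R θ (t k, ε k))
    (k : ℕ) : f (t k) + ε k ≤ ((1 + θ ^ 2) / 2) ^ k * (f (t 0) + ε 0) := by
  induction k with
  | zero => simp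
  | succ k ih =>
    have := h.add_nMap_le hθ0 hθ (h.mem_setA_of_nMap hθ0 hθ hA htε k)
    rw [← htε] at this
    refine this.trans ?_
    rw [pow_succ' ((1 + θ ^ 2) / 2) k, mul_assoc]
    exact mul_le_mul_of_nonneg_left ih (by positivity)

theorem tendsto_add_of_nMap (h : ScalarMajorant f R) (hθ0 : 0 ≤ θ) (hθ : θ ≤ thetaTilde f R)
    (hA : (t 0, ε 0) ∈ setA f R) (htε : ∀ k, (t (k + 1), ε (k + 1)) = nMap f R θ (t k, ε k)) :
    Tendsto (fun k => f (t k) + ε k) atTop (𝓝 0) := by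
  have hθ1 := h.theta_lt_one hθ
  have h1 : Tendsto (fun k : ℕ => ((1 + θ ^ 2) / 2) ^ k * (f (t 0) + ε 0)) atTop (𝓝 0) := by
    have := (tendsto_pow_atTop_nhds_zero_of_lt_one (r := (1 + θ ^ 2) / 2) (by positivity)
      (by nlinarith)).mul_const (f (t 0) + ε 0)
    simpa using this
  exact squeeze_zero (fun k => (h.mem_setA_of_nMap hθ0 hθ hA htε k).2.2.2.2.le)
    (h.add_le_pow_of_nMap hθ0 hθ hA htε) h1

/-- Otherwise `f` would be nonnegative and nonincreasing on `[0, R)`, hence zero after its root,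
although `f' < 0` there. -/
theorem lam_lt_of_kappa_eq_zero (h : ScalarMajorant f R) (hκ : kappa f R = 0) :
    lam f R < R := by
  obtain ⟨r, hr, hr0⟩ := h.exists_root
  by_contra! hc
  obtain ⟨s, hs⟩ := exists_between hr.2
  have hsl := hs.2.trans_le hc
  have h1 := h.add_kappa_antitone hr.1.le hs.1.le hsl
  have h2 := h.add_kappa_nonneg (t := s) ⟨hr.1.le.trans hs.1.le, hs.2⟩
  rw [hκ] at h1 h2
  obtain ⟨c, hc1, hc2⟩ := exists_hasDerivAt_eq_slope f (mderiv f R) hs.1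
    (h.continuousOn.mono fun x hx => ⟨hr.1.le.trans hx.1, hx.2.trans_lt hs.2⟩)
    (fun x hx => h.hasDerivAt ⟨hr.1.trans hx.1, hx.2.trans hs.2⟩)
  have h3 := h.mderiv_lt (hr.1.le.trans hc1.1.le) (hc1.2.trans hsl)
  have h4 : f s - f r = 0 := by linarith
  rw [h4, zero_div] at hc2
  linarith

/-- For `κ > 0` the limit is even below `λ`: the slack `κ t - ε` stays bounded away from `0`,
whereas `f + κ s` comes arbitrarily close to `0` near `λ`, so `f(t) + ε` would turn negative. -/
theorem lim_lt_of_nMap (h : ScalarMajorant f R) (hθ0 : 0 ≤ θ) (hθ : θ ≤ thetaTilde f R)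
    (hA : (t 0, ε 0) ∈ setA f R) (htε : ∀ k, (t (k + 1), ε (k + 1)) = nMap f R θ (t k, ε k))
    {tt : ℝ} (htt : Tendsto t atTop (𝓝 tt)) : tt < R := by
  have hmem := h.mem_setA_of_nMap hθ0 hθ hA htε
  have hmono := h.strictMono_of_nMap hθ0 hθ hA htε
  have hle : tt ≤ lam f R := le_of_tendsto' htt fun k => (hmem k).2.1.le
  rcases h.kappa_nonneg.eq_or_lt with hκ | hκ
  · exact hle.trans_lt (h.lam_lt_of_kappa_eq_zero hκ.symm)
  refine (lt_of_le_of_ne hle ?_).trans_le h.lam_le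
  rintro rfl
  -- The slack is measured from index `1`: `t 0` may be `0`, where `-f' = 1` and no slack is gained.
  have ht1 : 0 < t 1 := (hmem 0).1.trans_lt (hmono zero_lt_one)
  have ha1 : -1 < mderiv f R (t 1) := by
    rw [← h.deriv_zero]
    exact h.deriv_strictMono h.zero_mem ⟨ht1.le, (hmem 1).2.1.trans_le h.lam_le⟩ ht1
  have hε : ∀ k, ε (k + 1) - ε 1 ≤ kappa f R * -mderiv f R (t 1) * (t (k + 1) - t 1) := by
    intro k
    induction k with
    | zero => simp
    | succ k ih =>
      have e1 := h.nMap_snd_sub_le hθ (hmem (k + 1))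
      rw [← htε] at e1
      simp only at e1
      have e2 := h.mderiv_le ht1.le (hmono.monotone (show 1 ≤ k + 1 by omega))
        ((hmem (k + 1)).2.1.trans_le h.lam_le)
      have e3 : kappa f R * -mderiv f R (t (k + 1)) * (t (k + 1 + 1) - t (k + 1))
          ≤ kappa f R * -mderiv f R (t 1) * (t (k + 1 + 1) - t (k + 1)) :=
        mul_le_mul_of_nonneg_right (mul_le_mul_of_nonneg_left (by linarith) hκ.le)
          (sub_pos.2 (hmono (Nat.lt_succ_self _))).le
      linarith
  have hδ : 0 < kappa f R * (1 + mderiv f R (t 1)) * (t 2 - t 1) :=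
    mul_pos (mul_pos hκ (by linarith)) (sub_pos.2 (hmono one_lt_two))
  obtain ⟨s, hs, hs'⟩ := h.exists_add_kappa_lt_near (hmem 2).2.1 hδ
  obtain ⟨k, hk⟩ := (htt.eventually_const_lt hs.2).exists
  have h2k : 2 ≤ k := (hmono.lt_iff_lt.1 (hs.1.trans hk)).le
  obtain ⟨j, rfl⟩ : ∃ j, k = j + 1 := ⟨k - 1, by omega⟩
  have e1 := h.add_kappa_antitone ((hmem 2).1.trans hs.1.le) hk.le (hmem (j + 1)).2.1
  have e2 := hε j
  have e3 := (hmem (j + 1)).2.2.2.2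
  have e4 := (hmem 1).2.2.2.1
  have e5 : kappa f R * (1 + mderiv f R (t 1)) * (t 2 - t 1)
      ≤ kappa f R * (1 + mderiv f R (t 1)) * (t (j + 1) - t 1) :=
    mul_le_mul_of_nonneg_left (by linarith [hmono.monotone h2k])
      (mul_pos hκ (by linarith)).le
  simp only at e3 e4
  linarith

end ScalarMajorant

/-! ### Cone inclusions over a reflexive space. -/

variable {X Y : Type*} [NormedAddCommGroup X] [NormedSpace ℝ X]
  [NormedAddCommGroup Y] [NormedSpace ℝ Y]

theorem zero_mem_of_isClosed {C : ConvexCone ℝ Y} (hCne : (C : Set Y).Nonempty)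
    (hCcl : IsClosed (C : Set Y)) : (0 : Y) ∈ C := by
  obtain ⟨c, hc⟩ := hCne
  have h1 : Tendsto (fun s : ℝ => s • c) (𝓝[>] 0) (𝓝 0) := by
    have : Tendsto (fun s : ℝ => s • c) (𝓝 0) (𝓝 ((0 : ℝ) • c)) :=
      Continuous.tendsto (by fun_prop) _
    rw [zero_smul] at this
    exact this.mono_left nhdsWithin_le_nhds
  refine hCcl.mem_of_tendsto h1 ?_
  filter_upwards [self_mem_nhdsWithin] with s hs
  exact C.smul_mem hs hc

/-- Bounded ultrafilters of a reflexive space converge weakly, and the norm is weakly lower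
semicontinuous. -/
theorem exists_weak_limit (hrefl : Function.Surjective (NormedSpace.inclusionInDoubleDual ℝ X))
    {ι : Type*} (u : Ultrafilter ι) (d : ι → X) {r : ℝ} (hr : ∀ᶠ i in u, ‖d i‖ ≤ r) :
    ∃ x : X, (∀ ℓ : StrongDual ℝ X, Tendsto (fun i => ℓ (d i)) u (𝓝 (ℓ x))) ∧
      ∀ r', (∀ᶠ i in u, ‖d i‖ ≤ r') → ‖x‖ ≤ r' := by
  let J : X → WeakDual ℝ (StrongDual ℝ X) := fun x =>
    StrongDual.toWeakDual (NormedSpace.inclusionInDoubleDual ℝ X x)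
  obtain ⟨φ, -, hφ⟩ := (WeakDual.isCompact_closedBall (𝕜 := ℝ) (E := StrongDual ℝ X) 0 r
    ).ultrafilter_le_nhds (u.map (fun i => J (d i))) (by
      rw [le_principal_iff]
      change ∀ᶠ i in u, J (d i) ∈ _
      filter_upwards [hr] with i hi
      simp only [J, mem_preimage, mem_closedBall, dist_zero_right]
      exact (NormedSpace.double_dual_bound ℝ X (d i)).trans hi)
  obtain ⟨x, hx⟩ := hrefl (WeakDual.toStrongDual φ)
  have hlim : ∀ ℓ : StrongDual ℝ X, Tendsto (fun i => ℓ (d i)) u (𝓝 (ℓ x)) := by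
    intro ℓ
    have h1 : Tendsto (fun i => J (d i)) u (𝓝 φ) := hφ
    have h2 := ((WeakDual.eval_continuous (𝕜 := ℝ) ℓ).tendsto φ).comp h1
    have h3 : φ ℓ = ℓ x := by
      rw [← NormedSpace.dual_def ℝ X x ℓ, hx]
      rfl
    rw [h3] at h2
    exact h2
  refine ⟨x, hlim, fun r' hr' => ?_⟩
  have h0 : 0 ≤ r' := by
    obtain ⟨i, hi⟩ := hr'.exists
    exact (norm_nonneg _).trans hi
  refine NormedSpace.norm_le_dual_bound ℝ x h0 fun ℓ => ?_
  refine le_of_tendsto (hlim ℓ).norm ?_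
  filter_upwards [hr'] with i hi
  rw [mul_comm]
  exact (ℓ.le_opNorm _).trans (mul_le_mul_of_nonneg_left hi (norm_nonneg _))

/-- A closed convex cone is weakly closed: a functional separating the limit from `C` would separate
the approximating points as well. -/
theorem exists_feasible_limit
    (hrefl : Function.Surjective (NormedSpace.inclusionInDoubleDual ℝ X))
    {C : ConvexCone ℝ Y} (hCcl : IsClosed (C : Set Y)) (A : X →L[ℝ] Y)
    {ι : Type*} (u : Ultrafilter ι) (d : ι → X) {r : ℝ} (hr : ∀ᶠ i in u, ‖d i‖ ≤ r)
    {y : ι → Y} {z : Y} (hy : Tendsto y u (𝓝 z)) (hd : ∀ᶠ i in u, A (d i) - y i ∈ C) :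
    ∃ x : X, A x - z ∈ C ∧ ∀ r', (∀ᶠ i in u, ‖d i‖ ≤ r') → ‖x‖ ≤ r' := by
  obtain ⟨x, hx, hx'⟩ := exists_weak_limit hrefl u d hr
  refine ⟨x, ?_, hx'⟩
  by_contra hc
  obtain ⟨ℓ, s, hs1, hs2⟩ := geometric_hahn_banach_closed_point C.convex hCcl hc
  have h1 : Tendsto (fun i => ℓ (A (d i) - y i)) u (𝓝 (ℓ (A x - z))) := by
    simp only [map_sub]
    exact (hx (ℓ.comp A)).sub ((ℓ.continuous.tendsto z).comp hy)
  refine hs2.not_ge (le_of_tendsto h1 ?_)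
  filter_upwards [hd] with i hi
  exact (hs1 _ hi).le

/-- The direct method: the weak limit of a minimizing sequence is feasible and has minimal norm. -/
theorem exists_feasible_min
    (hrefl : Function.Surjective (NormedSpace.inclusionInDoubleDual ℝ X))
    {C : ConvexCone ℝ Y} (hCcl : IsClosed (C : Set Y)) (A : X →L[ℝ] Y) (y : Y)
    (hne : ∃ d, A d - y ∈ C) :
    ∃ d, A d - y ∈ C ∧ ∀ d', A d' - y ∈ C → ‖d‖ ≤ ‖d'‖ := by
  obtain ⟨d₀, hd₀⟩ := hne
  let S : Set ℝ := (fun d => ‖d‖) '' {d : X | A d - y ∈ C}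
  have hSne : S.Nonempty := ⟨_, d₀, hd₀, rfl⟩
  have hSbdd : BddBelow S := ⟨0, by rintro _ ⟨d, -, rfl⟩; exact norm_nonneg d⟩
  have hex : ∀ n : ℕ, ∃ d : X, A d - y ∈ C ∧ ‖d‖ < sInf S + 1 / ((n : ℝ) + 1) := by
    intro n
    obtain ⟨_, ⟨d, hd, rfl⟩, hlt⟩ := exists_lt_of_csInf_lt hSne
      (show sInf S < sInf S + 1 / ((n : ℝ) + 1) from lt_add_of_pos_right _ (by positivity))
    exact ⟨d, hd, hlt⟩
  choose d hd hlt using hex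
  have hbd : ∀ η > 0, ∀ᶠ n in (hyperfilter ℕ : Filter ℕ), ‖d n‖ ≤ sInf S + η := by
    intro η hη
    have h1 : ∀ᶠ n : ℕ in atTop, 1 / ((n : ℝ) + 1) < η :=
      tendsto_one_div_add_atTop_nhds_zero_nat.eventually_lt_const hη
    have h2 : (hyperfilter ℕ : Filter ℕ) ≤ atTop := Nat.hyperfilter_le_atTop
    filter_upwards [h2 h1] with n hn
    have hn' : 1 / ((n : ℝ) + 1) < η := hn
    linarith [hlt n]
  obtain ⟨x, hx, hx'⟩ := exists_feasible_limit hrefl hCcl A (hyperfilter ℕ) d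
    (hbd 1 one_pos) (y := fun _ => y) tendsto_const_nhds (Eventually.of_forall hd)
  refine ⟨x, hx, fun d' hd' => ?_⟩
  refine le_trans ?_ (csInf_le hSbdd ⟨d', hd', rfl⟩)
  exact le_of_forall_pos_le_add fun η hη => hx' _ (hbd η hη)

/-- A surjective closed convex process on a reflexive space has a bounded inverse. -/
theorem exists_feasible_bound [CompleteSpace Y]
    (hrefl : Function.Surjective (NormedSpace.inclusionInDoubleDual ℝ X))
    {C : ConvexCone ℝ Y} (hCcl : IsClosed (C : Set Y)) (A : X →L[ℝ] Y)
    (hsurj : ∀ y, ∃ d, A d - y ∈ C) :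
    ∃ c : ℝ, ∀ y, ∃ d, A d - y ∈ C ∧ ‖d‖ ≤ c * ‖y‖ := by
  let U : ℕ → Set Y := fun n => {y | ∃ d, A d - y ∈ C ∧ ‖d‖ ≤ n}
  have hUcl : ∀ n, IsClosed (U n) := by
    intro n
    refine isClosed_iff_ultrafilter.2 fun z u hu hmem => ?_
    have hex : ∀ y : Y, ∃ d : X, y ∈ U n → A d - y ∈ C ∧ ‖d‖ ≤ n := by
      intro y
      by_cases hy : y ∈ U n
      · obtain ⟨d, hd⟩ := hy
        exact ⟨d, fun _ => hd⟩
      · exact ⟨0, fun h => absurd h hy⟩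
    choose d hd using hex
    have hev : ∀ᶠ y in (u : Filter Y), y ∈ U n := hmem
    obtain ⟨x, hx, hx'⟩ := exists_feasible_limit hrefl hCcl A u d
      (hev.mono fun y hy => (hd y hy).2) (y := id) hu (hev.mono fun y hy => (hd y hy).1)
    exact ⟨x, hx, hx' _ (hev.mono fun y hy => (hd y hy).2)⟩
  have hUun : ⋃ n, U n = univ := by
    refine eq_univ_of_forall fun y => ?_
    obtain ⟨d, hd⟩ := hsurj y
    obtain ⟨n, hn⟩ := exists_nat_ge ‖d‖
    exact mem_iUnion.2 ⟨n, d, hd, hn⟩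
  -- Baire's theorem gives a ball around some `y₁`. A solution `e` for `-y₁` moves it to the origin,
  -- and homogeneity does the rest.
  obtain ⟨n, y₁, hy₁⟩ := nonempty_interior_of_iUnion_of_closed hUcl hUun
  obtain ⟨δ, hδ, hball⟩ := Metric.isOpen_iff.1 isOpen_interior y₁ hy₁
  obtain ⟨e, he⟩ := hsurj (-y₁)
  set M : ℝ := n + ‖e‖ with hM
  have hM0 : 0 ≤ M := by positivity
  refine ⟨M * (2 / δ), fun y => ?_⟩
  rcases eq_or_ne y 0 with rfl | hy
  · refine ⟨0, ?_, by simp⟩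
    simpa using zero_mem_of_isClosed ⟨_, he⟩ hCcl
  · have hyn : 0 < ‖y‖ := norm_pos_iff.2 hy
    set s : ℝ := 2 / δ * ‖y‖ with hs
    have hs0 : 0 < s := by positivity
    have hmem : y₁ + s⁻¹ • y ∈ U n := by
      refine interior_subset (hball ?_)
      rw [mem_ball, dist_eq_norm, add_sub_cancel_left, norm_smul, norm_inv, Real.norm_eq_abs,
        abs_of_pos hs0, hs]
      field_simp
      linarith
    obtain ⟨d, hd, hdn⟩ := hmem
    refine ⟨s • (d + e), ?_, ?_⟩
    · have := C.smul_mem hs0 (C.add_mem hd he)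
      convert this using 1
      rw [map_smul, map_add]
      have : y = s • (s⁻¹ • y) := by rw [smul_smul, mul_inv_cancel₀ hs0.ne', one_smul]
      nth_rw 1 [this]
      rw [← smul_sub]
      congr 1
      abel
    · rw [norm_smul, Real.norm_eq_abs, abs_of_pos hs0, hs]
      have : ‖d + e‖ ≤ M := (norm_add_le _ _).trans (by rw [hM]; linarith)
      calc 2 / δ * ‖y‖ * ‖d + e‖ ≤ 2 / δ * ‖y‖ * M := by gcongr
        _ = _ := by ring

/-! ### The minimal-norm function as a sublinear function, duality and perturbation. -/

/-- The smallest norm of a solution `d` of the inclusion `A d - y ∈ C`. -/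
noncomputable def feasNorm (C : ConvexCone ℝ Y) (A : X →L[ℝ] Y) (y : Y) : ℝ :=
  sInf ((fun d => ‖d‖) '' {d : X | A d - y ∈ C})

section FeasNorm

variable {C : ConvexCone ℝ Y} {A : X →L[ℝ] Y}

theorem feasNorm_le {y : Y} {d : X} (hd : A d - y ∈ C) : feasNorm C A y ≤ ‖d‖ :=
  csInf_le ⟨0, by rintro _ ⟨d, -, rfl⟩; exact norm_nonneg d⟩ ⟨d, hd, rfl⟩

theorem feasNorm_nonneg (y : Y) : 0 ≤ feasNorm C A y :=
  Real.sInf_nonneg (by rintro _ ⟨d, -, rfl⟩; exact norm_nonneg d)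

/-- Attainment of minimal norms in the inclusions `A d - y ∈ C`. -/
def HasMinSolutions (C : ConvexCone ℝ Y) (A : X →L[ℝ] Y) : Prop :=
  ∀ y, ∃ d, A d - y ∈ C ∧ ‖d‖ = feasNorm C A y

theorem hasMinSolutions (hrefl : Function.Surjective (NormedSpace.inclusionInDoubleDual ℝ X))
    (hCcl : IsClosed (C : Set Y)) (hsurj : ∀ y, ∃ d, A d - y ∈ C) : HasMinSolutions C A := by
  intro y
  obtain ⟨d, hd, hd'⟩ := exists_feasible_min hrefl hCcl A y (hsurj y)
  refine ⟨d, hd, le_antisymm ?_ (feasNorm_le hd)⟩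
  refine le_csInf ⟨_, d, hd, rfl⟩ ?_
  rintro _ ⟨d', hd2, rfl⟩
  exact hd' d' hd2

theorem feasNorm_add_le (h : HasMinSolutions C A) (y z : Y) :
    feasNorm C A (y + z) ≤ feasNorm C A y + feasNorm C A z := by
  obtain ⟨d, hd, hd'⟩ := h y
  obtain ⟨e, he, he'⟩ := h z
  rw [← hd', ← he']
  refine (feasNorm_le ?_).trans (norm_add_le d e)
  have := C.add_mem hd he
  convert this using 1
  rw [map_add]
  abel

theorem feasNorm_smul_le (h : HasMinSolutions C A) {s : ℝ} (hs : 0 < s) (y : Y) :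
    feasNorm C A (s • y) ≤ s * feasNorm C A y := by
  obtain ⟨d, hd, hd'⟩ := h y
  rw [← hd']
  have h1 : A (s • d) - s • y ∈ C := by
    rw [map_smul, ← smul_sub]
    exact C.smul_mem hs hd
  refine (feasNorm_le h1).trans (le_of_eq ?_)
  rw [norm_smul, Real.norm_eq_abs, abs_of_pos hs]

theorem feasNorm_smul (h : HasMinSolutions C A) {s : ℝ} (hs : 0 < s) (y : Y) :
    feasNorm C A (s • y) = s * feasNorm C A y := by
  refine le_antisymm (feasNorm_smul_le h hs y) ?_
  have := feasNorm_smul_le h (inv_pos.2 hs) (s • y)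
  rw [smul_smul, inv_mul_cancel₀ hs.ne', one_smul] at this
  calc s * feasNorm C A y ≤ s * (s⁻¹ * feasNorm C A (s • y)) :=
        mul_le_mul_of_nonneg_left this hs.le
    _ = feasNorm C A (s • y) := by rw [← mul_assoc, mul_inv_cancel₀ hs.ne', one_mul]

theorem feasNorm_neg_of_mem {c : Y} (hc : c ∈ C) : feasNorm C A (-c) = 0 := by
  refine le_antisymm ?_ (feasNorm_nonneg _)
  have := feasNorm_le (C := C) (A := A) (y := -c) (d := 0) (by simpa using hc)
  simpa using this

theorem feasNorm_map_le (h0 : (0 : Y) ∈ C) (d : X) : feasNorm C A (A d) ≤ ‖d‖ :=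
  feasNorm_le (by simpa using h0)

/-- The smallest norm is the support function of its continuous linear minorants. -/
theorem exists_dual_feasNorm (h : HasMinSolutions C A) {c : ℝ}
    (hc : ∀ y, feasNorm C A y ≤ c * ‖y‖) (y : Y) :
    ∃ ℓ : StrongDual ℝ Y, (∀ z, ℓ z ≤ feasNorm C A z) ∧ ℓ y = feasNorm C A y := by
  have h0 : feasNorm C A 0 = 0 := by
    refine le_antisymm ?_ (feasNorm_nonneg _)
    simpa using hc 0
  have H : ∀ s : ℝ, s • y = 0 → (RingHom.id ℝ) s • feasNorm C A y = 0 := by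
    intro s hs
    rcases smul_eq_zero.1 hs with rfl | rfl
    · simp
    · simp [h0]
  -- Hahn–Banach extends `s • y ↦ s * feasNorm C A y` from the line through `y`; for `s < 0`
  -- domination holds since `feasNorm` is nonnegative.
  obtain ⟨g, hg1, hg2⟩ := exists_extension_of_le_sublinear
    (LinearPMap.mkSpanSingleton' y (feasNorm C A y) H) (feasNorm C A)
    (fun s hs z => feasNorm_smul h hs z) (feasNorm_add_le h) (by
      rintro ⟨x, hx⟩
      obtain ⟨s, rfl⟩ := Submodule.mem_span_singleton.1 hx
      rw [LinearPMap.mkSpanSingleton'_apply, RingHom.id_apply, smul_eq_mul]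
      rcases lt_trichotomy s 0 with hs | hs | hs
      · exact (mul_nonpos_of_nonpos_of_nonneg hs.le (feasNorm_nonneg _)).trans
          (feasNorm_nonneg _)
      · simp [hs, h0]
      · exact (feasNorm_smul h hs y).ge)
  have hgy : g y = feasNorm C A y := by
    rw [← LinearPMap.mkSpanSingleton'_apply_self y (feasNorm C A y) H
      (Submodule.mem_span_singleton_self y)]
    exact hg1 ⟨y, Submodule.mem_span_singleton_self y⟩
  refine ⟨g.mkContinuous c fun z => ?_, hg2, hgy⟩
  rw [Real.norm_eq_abs, abs_le]
  have h1 := (hg2 z).trans (hc z)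
  have h2 := (hg2 (-z)).trans (hc (-z))
  rw [map_neg, norm_neg] at h2
  exact ⟨by linarith, h1⟩

/-- Solvability is stable under perturbations `B` of `A` that are small in the sense of the
inverse process. -/
theorem exists_feasible_perturb [CompleteSpace X] (hCcl : IsClosed (C : Set Y))
    (h : HasMinSolutions C A) {B : X →L[ℝ] Y} {q : ℝ} (hq0 : 0 ≤ q) (hq : q < 1)
    (hB : ∀ d, feasNorm C A (-(B d)) ≤ q * ‖d‖) (y : Y) :
    ∃ d, (A + B) d - y ∈ C ∧ ‖d‖ ≤ feasNorm C A y / (1 - q) := by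
  choose σ hσ hσ' using h
  -- Each term corrects the error `B (d n)` caused by its predecessor, so the norms decay like `q ^
  -- n`.
  let d : ℕ → X := fun n => Nat.rec (σ y) (fun _ x => σ (-(B x))) n
  have hd0 : d 0 = σ y := rfl
  have hds : ∀ n, d (n + 1) = σ (-(B (d n))) := fun _ => rfl
  have hnorm : ∀ n, ‖d n‖ ≤ feasNorm C A y * q ^ n := by
    intro n
    induction n with
    | zero => simp [hd0, hσ']
    | succ n ih =>
      rw [hds, hσ']
      refine (hB _).trans ((mul_le_mul_of_nonneg_left ih hq0).trans (le_of_eq ?_))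
      ring
  have hgeo := (hasSum_geometric_of_lt_one hq0 hq).mul_left (feasNorm C A y)
  have hsum : Summable d := Summable.of_norm_bounded hgeo.summable hnorm
  refine ⟨∑' n, d n, ?_, ?_⟩
  -- `A` runs one term ahead of `B`: a new term of `B` is compensated, up to an element of `C`, by
  -- the next term of `A`.
  · have hpart : ∀ n, A (∑ i ∈ Finset.range (n + 1), d i)
        + B (∑ i ∈ Finset.range n, d i) - y ∈ C := by
      intro n
      induction n with
      | zero => simpa [hd0] using hσ y
      | succ n ih =>
        have h1 := hσ (-(B (d n)))
        rw [← hds] at h1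
        convert C.add_mem ih h1 using 1
        rw [Finset.sum_range_succ _ (n + 1), Finset.sum_range_succ (fun i => d i) n]
        simp only [map_add]
        abel
    have hlim := hsum.hasSum.tendsto_sum_nat
    have hlim' := (tendsto_add_atTop_iff_nat 1).2 hlim
    have hT := (((A.continuous.tendsto _).comp hlim').add
      ((B.continuous.tendsto _).comp hlim)).sub_const y
    exact hCcl.mem_of_tendsto hT (Eventually.of_forall hpart)
  · have := tsum_of_norm_bounded hgeo hnorm
    rwa [← div_eq_mul_inv] at this

end FeasNorm

/-! ### The majorant condition in real terms, and estimates for one Newton step. -/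

theorem setNorm_invProcess {F : X → Y} {C : ConvexCone ℝ Y} {x₀ : X}
    (h : HasMinSolutions C (fderiv ℝ F x₀)) (y : Y) :
    setNorm (invProcess F C x₀ y) = ENNReal.ofReal (feasNorm C (fderiv ℝ F x₀) y) := by
  obtain ⟨d, hd, hd'⟩ := h y
  refine le_antisymm ?_ ?_
  · rw [← hd', ofReal_norm]
    exact iInf₂_le d ((mem_invProcess_iff F C x₀ y d).2 hd)
  · refine le_iInf₂ fun e he => ?_
    rw [← ofReal_norm]
    exact ENNReal.ofReal_le_ofReal (feasNorm_le ((mem_invProcess_iff F C x₀ y e).1 he))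

theorem coe_ofReal_le_coe {a b : ℝ} (ha : 0 ≤ a) :
    ((ENNReal.ofReal a : ℝ≥0∞) : EReal) ≤ ((b : ℝ) : EReal) ↔ a ≤ b := by
  rw [EReal.coe_ennreal_ofReal, max_eq_left ha, EReal.coe_le_coe_iff]

/-- The standing assumptions on `F`, `C`, `x₀` and the majorant function, in terms of the real
valued smallest norm of the solutions of `F'(x₀) d - y ∈ C`. -/
structure NewtonSetting (F : X → Y) (C : ConvexCone ℝ Y) (x₀ : X) (R : ℝ) (f : ℝ → ℝ) :
    Prop where
  refl : Function.Surjective (NormedSpace.inclusionInDoubleDual ℝ X)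
  zero_mem : (0 : Y) ∈ C
  isClosed : IsClosed (C : Set Y)
  scalar : ScalarMajorant f R
  differentiableAt : ∀ x ∈ ball x₀ R, DifferentiableAt ℝ F x
  min : HasMinSolutions C (fderiv ℝ F x₀)
  bounded : ∃ c : ℝ, ∀ y, feasNorm C (fderiv ℝ F x₀) y ≤ c * ‖y‖
  bound : ∀ x ∈ ball x₀ R, ∀ y ∈ ball x₀ R, ‖x - x₀‖ + ‖y - x‖ < R → ∀ d,
    feasNorm C (fderiv ℝ F x₀) ((fderiv ℝ F y - fderiv ℝ F x) d) ≤
      (mderiv f R (‖x - x₀‖ + ‖y - x‖) - mderiv f R ‖x - x₀‖) * ‖d‖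

/-- The process norm sees only the unit ball; positive homogeneity extends the bound to all `d`. -/
theorem feasNorm_le_of_processNorm_le {F : X → Y} {C : ConvexCone ℝ Y} {x₀ : X}
    (h0 : (0 : Y) ∈ C) (h : HasMinSolutions C (fderiv ℝ F x₀)) {B : X →L[ℝ] Y} {L : ℝ}
    (hB : (processNorm (fun d : X => invProcess F C x₀ (B d)) : EReal) ≤ ((L : ℝ) : EReal))
    (d : X) : feasNorm C (fderiv ℝ F x₀) (B d) ≤ L * ‖d‖ := by
  rcases eq_or_ne d 0 with rfl | hd
  · have := feasNorm_map_le (A := fderiv ℝ F x₀) h0 0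
    simpa using this
  have hdn : 0 < ‖d‖ := norm_pos_iff.2 hd
  set e : X := ‖d‖⁻¹ • d with he
  have hde : d = ‖d‖ • e := by rw [he, smul_smul, mul_inv_cancel₀ hdn.ne', one_smul]
  have hen : ‖e‖ ≤ 1 := by
    rw [he, norm_smul, norm_inv, norm_norm, inv_mul_cancel₀ hdn.ne']
  have h1 : setNorm (invProcess F C x₀ (B e)) ≤
      processNorm (fun d : X => invProcess F C x₀ (B d)) := by
    obtain ⟨w, hw, -⟩ := h (B e)
    refine le_iSup₂ (f := fun (d : X) (_ : d ∈ {d : X | (invProcess F C x₀ (B d)).Nonempty ∧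
      ‖d‖ ≤ 1}) => setNorm (invProcess F C x₀ (B d))) e ?_
    exact ⟨⟨w, (mem_invProcess_iff F C x₀ _ w).2 hw⟩, hen⟩
  have h2 := (EReal.coe_ennreal_le_coe_ennreal_iff.2 h1).trans hB
  rw [setNorm_invProcess h, coe_ofReal_le_coe (feasNorm_nonneg _)] at h2
  rw [hde, map_smul, feasNorm_smul h hdn, ← hde, mul_comm]
  exact mul_le_mul_of_nonneg_right h2 hdn.le

theorem IsMajorant.scalarMajorant {F : X → Y} {C : ConvexCone ℝ Y} {Ω : Set X} {x₀ : X} {R : ℝ}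
    {f : ℝ → ℝ} (hf : IsMajorant F C Ω x₀ R f) : ScalarMajorant f R :=
  ⟨hf.contDiffOn, hf.zero_pos, hf.deriv_zero, hf.deriv_convex, hf.deriv_strictMono,
    hf.exists_root⟩

theorem IsMajorant.newtonSetting [CompleteSpace Y] {F : X → Y} {C : ConvexCone ℝ Y} {Ω : Set X}
    {x₀ : X} {R : ℝ} {f : ℝ → ℝ} (hf : IsMajorant F C Ω x₀ R f)
    (hrefl : Function.Surjective (NormedSpace.inclusionInDoubleDual ℝ X))
    (hCne : (C : Set Y).Nonempty) (hCcl : IsClosed (C : Set Y))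
    (hΩ : IsOpen Ω) (hF : ContDiffOn ℝ 1 F Ω) (hRob : RobinsonCondition F C x₀) :
    NewtonSetting F C x₀ R f := by
  have hsurj : ∀ y, ∃ d, fderiv ℝ F x₀ d - y ∈ C := by
    intro y
    obtain ⟨d, hd⟩ := hRob y
    exact ⟨d, (mem_invProcess_iff F C x₀ y d).1 hd⟩
  have hmin := hasMinSolutions hrefl hCcl hsurj
  have h0 := zero_mem_of_isClosed hCne hCcl
  refine ⟨hrefl, h0, hCcl, hf.scalarMajorant, ?_, hmin, ?_, ?_⟩
  · intro x hx
    have hxΩ := hf.ball_subset hx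
    exact (hF.contDiffAt (hΩ.mem_nhds hxΩ)).differentiableAt one_ne_zero
  · obtain ⟨c, hc⟩ := exists_feasible_bound hrefl hCcl _ hsurj
    refine ⟨c, fun y => ?_⟩
    obtain ⟨d, hd, hd'⟩ := hc y
    exact (feasNorm_le hd).trans hd'
  · intro x hx y hy hxy d
    exact feasNorm_le_of_processNorm_le h0 hmin (hf.bound x hx y hy hxy) d

namespace NewtonSetting

variable {F : X → Y} {C : ConvexCone ℝ Y} {x₀ : X} {R θ : ℝ} {f : ℝ → ℝ}

theorem mem_ball_of_add_lt {E : Type*} [SeminormedAddCommGroup E] {x₀ x d : E}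
    (hd : ‖x - x₀‖ + ‖d‖ < R) : x + d ∈ ball x₀ R := by
  rw [mem_ball, dist_eq_norm]
  have : x + d - x₀ = (x - x₀) + d := by abel
  rw [this]
  exact (norm_add_le _ _).trans_lt hd

/-- After applying `ℓ`, both linearization errors are increments over `[0, 1]` of real functions
whose derivatives are compared by `hℓ`. -/
theorem dual_linearization_le (h : NewtonSetting F C x₀ R f) {x d : X} (hd0 : d ≠ 0)
    (hd : ‖x - x₀‖ + ‖d‖ < R) (ℓ : StrongDual ℝ Y)
    (hℓ : ∀ s ∈ Ioo (0 : ℝ) 1, ℓ ((fderiv ℝ F (x + s • d) - fderiv ℝ F x) d) ≤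
      (mderiv f R (‖x - x₀‖ + s * ‖d‖) - mderiv f R ‖x - x₀‖) * ‖d‖) :
    ℓ (F (x + d) - F x - fderiv ℝ F x d) ≤
      f (‖x - x₀‖ + ‖d‖) - f ‖x - x₀‖ - mderiv f R ‖x - x₀‖ * ‖d‖ := by
  have hdn : 0 < ‖d‖ := norm_pos_iff.2 hd0
  have hball : ∀ s ∈ Icc (0 : ℝ) 1, x + s • d ∈ ball x₀ R := by
    intro s hs
    refine mem_ball_of_add_lt (lt_of_le_of_lt ?_ hd)
    rw [norm_smul, Real.norm_eq_abs, abs_of_nonneg hs.1]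
    nlinarith [hs.2]
  have hderF : ∀ s ∈ Icc (0 : ℝ) 1,
      HasDerivAt (fun s : ℝ => ℓ (F (x + s • d)) - s * ℓ (fderiv ℝ F x d))
        (ℓ ((fderiv ℝ F (x + s • d) - fderiv ℝ F x) d)) s := by
    intro s hs
    have h1 : HasDerivAt (fun s : ℝ => x + s • d) d s := by
      have := ((hasDerivAt_id' s).smul_const d).const_add x
      rwa [one_smul] at this
    have h2 := (h.differentiableAt _ (hball s hs)).hasFDerivAt.comp_hasDerivAt s h1
    have h3 := (ℓ.hasFDerivAt.comp_hasDerivAt s h2).sub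
      ((hasDerivAt_id' s).mul_const (ℓ (fderiv ℝ F x d)))
    refine h3.congr_deriv ?_
    simp
  have hmem : ∀ s ∈ Icc (0 : ℝ) 1, ‖x - x₀‖ + s * ‖d‖ ∈ Ico 0 R := by
    intro s hs
    have : 0 ≤ s * ‖d‖ := mul_nonneg hs.1 hdn.le
    refine ⟨by positivity, lt_of_le_of_lt ?_ hd⟩
    nlinarith [hs.2]
  have hderf : ∀ s ∈ Ioo (0 : ℝ) 1,
      HasDerivAt (fun s : ℝ => f (‖x - x₀‖ + s * ‖d‖) - s * (mderiv f R ‖x - x₀‖ * ‖d‖))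
        ((mderiv f R (‖x - x₀‖ + s * ‖d‖) - mderiv f R ‖x - x₀‖) * ‖d‖) s := by
    intro s hs
    have h1 : HasDerivAt (fun s : ℝ => ‖x - x₀‖ + s * ‖d‖) ‖d‖ s := by
      have := ((hasDerivAt_id' s).mul_const ‖d‖).const_add ‖x - x₀‖
      rwa [one_mul] at this
    have h4 : 0 < s * ‖d‖ := mul_pos hs.1 hdn
    have h2 := (h.scalar.hasDerivAt (t := ‖x - x₀‖ + s * ‖d‖)
      ⟨by positivity, (hmem s (Ioo_subset_Icc_self hs)).2⟩).comp s h1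
    have h3 := h2.sub ((hasDerivAt_id' s).mul_const (mderiv f R ‖x - x₀‖ * ‖d‖))
    refine h3.congr_deriv ?_
    ring
  have key := sub_le_sub_of_hasDerivAt_le zero_le_one
    (fun s hs => (hderF s hs).continuousAt.continuousWithinAt)
    (ContinuousOn.sub (h.scalar.continuousOn.comp (by fun_prop) hmem) (by fun_prop))
    (fun s hs => hderF s (Ioo_subset_Icc_self hs)) hderf hℓ
  simp only [Pi.sub_apply, Function.comp_apply, one_smul, one_mul, zero_smul, zero_mul, add_zero,
    sub_zero] at key
  rw [map_sub, map_sub]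
  linarith

/-- `feasNorm` is not symmetric, so both signs are needed: the negative one for the next residual,
the positive one for bounding a residual by the distance to a solution. -/
theorem feasNorm_linearization_le (h : NewtonSetting F C x₀ R f) {x d : X}
    (hd : ‖x - x₀‖ + ‖d‖ < R) :
    feasNorm C (fderiv ℝ F x₀) (F (x + d) - F x - fderiv ℝ F x d) ≤
        f (‖x - x₀‖ + ‖d‖) - f ‖x - x₀‖ - mderiv f R ‖x - x₀‖ * ‖d‖ ∧
      feasNorm C (fderiv ℝ F x₀) (-(F (x + d) - F x - fderiv ℝ F x d)) ≤
        f (‖x - x₀‖ + ‖d‖) - f ‖x - x₀‖ - mderiv f R ‖x - x₀‖ * ‖d‖ := by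
  obtain ⟨c, hc⟩ := h.bounded
  rcases eq_or_ne d 0 with rfl | hd0
  · have := hc 0
    simp only [norm_zero, mul_zero] at this
    simpa using this
  have hx : x ∈ ball x₀ R := by
    have := mem_ball_of_add_lt (x₀ := x₀) (x := x) (d := 0) (R := R)
      (by rw [norm_zero]; linarith [norm_nonneg d])
    simpa using this
  have hB : ∀ e : X, ‖e‖ = ‖d‖ → ∀ s ∈ Ioo (0 : ℝ) 1,
      feasNorm C (fderiv ℝ F x₀) ((fderiv ℝ F (x + s • d) - fderiv ℝ F x) e) ≤
      (mderiv f R (‖x - x₀‖ + s * ‖d‖) - mderiv f R ‖x - x₀‖) * ‖d‖ := by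
    intro e he s hs
    have hn : ‖s • d‖ = s * ‖d‖ := by rw [norm_smul, Real.norm_eq_abs, abs_of_pos hs.1]
    have hlt : ‖x - x₀‖ + ‖s • d‖ < R := by
      rw [hn]
      nlinarith [hs.2, norm_nonneg d]
    have h2 := h.bound x hx _ (mem_ball_of_add_lt hlt) (by rwa [add_sub_cancel_left]) e
    rwa [add_sub_cancel_left, hn, he] at h2
  constructor
  · obtain ⟨ℓ, hℓ, hℓ'⟩ := exists_dual_feasNorm h.min hc (F (x + d) - F x - fderiv ℝ F x d)
    rw [← hℓ']
    exact h.dual_linearization_le hd0 hd ℓ fun s hs => (hℓ _).trans (hB d rfl s hs)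
  · obtain ⟨ℓ, hℓ, hℓ'⟩ := exists_dual_feasNorm h.min hc (-(F (x + d) - F x - fderiv ℝ F x d))
    rw [← hℓ', map_neg]
    -- The sign is moved into the direction: the majorant bound is applied to `-d`, which has the
    -- same norm.
    refine h.dual_linearization_le hd0 hd (-ℓ) fun s hs => ?_
    have := (hℓ _).trans (hB (-d) (norm_neg d) s hs)
    rwa [map_neg, map_neg] at this

theorem mem_ball_R_of_mem_ball_tbar (h : NewtonSetting F C x₀ R f) {x : X}
    (hx : x ∈ ball x₀ (tbar f R)) : x ∈ ball x₀ R :=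
  ball_subset_ball h.scalar.tbar_le hx

theorem feasNorm_fderiv_sub_le (h : NewtonSetting F C x₀ R f) {x : X} (hx : x ∈ ball x₀ R)
    (d : X) : feasNorm C (fderiv ℝ F x₀) ((fderiv ℝ F x - fderiv ℝ F x₀) d) ≤
      (mderiv f R ‖x - x₀‖ + 1) * ‖d‖ := by
  have hx' : ‖x - x₀‖ < R := by rwa [← dist_eq_norm]
  have := h.bound x₀ (mem_ball_self h.scalar.R_pos) x hx (by simpa using hx') d
  simpa [h.scalar.deriv_zero] using this

theorem feasNorm_fderiv_le (h : NewtonSetting F C x₀ R f) {x : X} (hx : x ∈ ball x₀ R)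
    (d : X) : feasNorm C (fderiv ℝ F x₀) (fderiv ℝ F x d) ≤ (2 + mderiv f R ‖x - x₀‖) * ‖d‖ := by
  have h1 := feasNorm_add_le h.min (fderiv ℝ F x₀ d) ((fderiv ℝ F x - fderiv ℝ F x₀) d)
  have h2 := feasNorm_map_le (A := fderiv ℝ F x₀) h.zero_mem d
  have h3 := h.feasNorm_fderiv_sub_le hx d
  have h4 : fderiv ℝ F x₀ d + (fderiv ℝ F x - fderiv ℝ F x₀) d = fderiv ℝ F x d := by simp
  rw [h4] at h1
  linarith

/-- `F'(x)` is a perturbation of `F'(x₀)` of relative size `q = f'(‖x - x₀‖) + 1`, and `q < 1`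
because `‖x - x₀‖ < t̄`. -/
theorem exists_feasible_step [CompleteSpace X] (h : NewtonSetting F C x₀ R f) {x : X}
    (hx : x ∈ ball x₀ (tbar f R)) (y : Y) :
    ∃ d, fderiv ℝ F x d - y ∈ C ∧
      ‖d‖ ≤ feasNorm C (fderiv ℝ F x₀) y / -mderiv f R ‖x - x₀‖ := by
  have hxR := h.mem_ball_R_of_mem_ball_tbar hx
  have hx' : ‖x - x₀‖ < tbar f R := by rwa [← dist_eq_norm]
  have hneg := h.scalar.mderiv_neg_of_lt_tbar (norm_nonneg _) hx'
  have hge := h.scalar.neg_one_le_mderiv ⟨norm_nonneg (x - x₀), hx'.trans_le h.scalar.tbar_le⟩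
  obtain ⟨d, hd, hd'⟩ := exists_feasible_perturb h.isClosed h.min
    (B := fderiv ℝ F x - fderiv ℝ F x₀) (q := mderiv f R ‖x - x₀‖ + 1) (by linarith)
    (by linarith) (fun d => by
      have := h.feasNorm_fderiv_sub_le hxR (-d)
      rwa [map_neg, norm_neg] at this) y
  refine ⟨d, by rwa [add_sub_cancel] at hd, hd'.trans (le_of_eq ?_)⟩
  congr 1
  ring

theorem mem_stepSet_iff_cond {x d : X} {r : Y} :
    F x + fderiv ℝ F x d + r ∈ C ↔ fderiv ℝ F x d - (-F x + -r) ∈ C := by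
  have : fderiv ℝ F x d - (-F x + -r) = F x + fderiv ℝ F x d + r := by abel
  rw [this]

theorem stepSet_nonempty [CompleteSpace X] (h : NewtonSetting F C x₀ R f) {x : X}
    (hx : x ∈ ball x₀ (tbar f R)) (r : Y) : (stepSet F C x r).Nonempty := by
  obtain ⟨d, hd, hmin⟩ := exists_feasible_min h.refl h.isClosed (fderiv ℝ F x) (-F x + -r)
    ((h.exists_feasible_step hx _).imp fun _ hd => hd.1)
  exact ⟨d, mem_stepSet_iff_cond.2 hd, fun d' hd' => hmin d' (mem_stepSet_iff_cond.1 hd')⟩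

theorem mem_residuals_iff (h : NewtonSetting F C x₀ R f) (hθ0 : 0 ≤ θ) {x : X} {r : Y} :
    r ∈ residuals F C x₀ θ x ↔
      feasNorm C (fderiv ℝ F x₀) (-r) ≤ θ * feasNorm C (fderiv ℝ F x₀) (-F x) ∧
      feasNorm C (fderiv ℝ F x₀) r ≤ θ * feasNorm C (fderiv ℝ F x₀) (-F x) := by
  have h1 : 0 ≤ θ * feasNorm C (fderiv ℝ F x₀) (-F x) := mul_nonneg hθ0 (feasNorm_nonneg _)
  simp only [residuals, mem_ofPred_eq, setNorm_invProcess h.min, max_le_iff,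
    ← ENNReal.ofReal_mul hθ0, ENNReal.ofReal_le_ofReal_iff h1]

theorem mem_setK_iff (h : NewtonSetting F C x₀ R f) {x : X} {t ε : ℝ} :
    x ∈ setK F C x₀ f t ε ↔
      ‖x - x₀‖ ≤ t ∧ feasNorm C (fderiv ℝ F x₀) (-F x) ≤ f t + ε := by
  simp only [setK, mem_ofPred_eq, setNorm_invProcess h.min, coe_ofReal_le_coe (feasNorm_nonneg _)]

theorem norm_step_le [CompleteSpace X] (h : NewtonSetting F C x₀ R f) (hθ0 : 0 ≤ θ) {x d : X}
    (hx : x ∈ ball x₀ (tbar f R)) {r : Y} (hr : r ∈ residuals F C x₀ θ x)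
    (hd : d ∈ stepSet F C x r) :
    ‖d‖ ≤ (1 + θ) * feasNorm C (fderiv ℝ F x₀) (-F x) / -mderiv f R ‖x - x₀‖ := by
  have hx' : ‖x - x₀‖ < tbar f R := by rwa [← dist_eq_norm]
  have hneg := h.scalar.mderiv_neg_of_lt_tbar (norm_nonneg _) hx'
  obtain ⟨e, he, he'⟩ := h.exists_feasible_step hx (-F x + -r)
  refine (hd.2 e (mem_stepSet_iff_cond.2 he)).trans (he'.trans ?_)
  refine div_le_div_of_nonneg_right ?_ (by linarith)
  have h1 := feasNorm_add_le h.min (-F x) (-r)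
  have h2 := ((h.mem_residuals_iff hθ0).1 hr).1
  linarith

/-- With `c = F(x) + F'(x) d + r ∈ C`, the new residual is `-c`, plus `r`, minus the linearization
error, and `-c` costs nothing. -/
theorem feasNorm_next_le (h : NewtonSetting F C x₀ R f) (hθ0 : 0 ≤ θ) {x d : X} {r : Y}
    (hr : r ∈ residuals F C x₀ θ x) (hd : d ∈ stepSet F C x r) (hxd : ‖x - x₀‖ + ‖d‖ < R) :
    feasNorm C (fderiv ℝ F x₀) (-F (x + d)) ≤ θ * feasNorm C (fderiv ℝ F x₀) (-F x) +
      (f (‖x - x₀‖ + ‖d‖) - f ‖x - x₀‖ - mderiv f R ‖x - x₀‖ * ‖d‖) := by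
  have h1 := (h.feasNorm_linearization_le hxd).2
  have h2 := ((h.mem_residuals_iff hθ0).1 hr).2
  have h3 := feasNorm_neg_of_mem (A := fderiv ℝ F x₀) hd.1
  have h4 := feasNorm_add_le h.min (-(F x + fderiv ℝ F x d + r))
    (r + -(F (x + d) - F x - fderiv ℝ F x d))
  have h5 := feasNorm_add_le h.min r (-(F (x + d) - F x - fderiv ℝ F x d))
  have h6 : -(F x + fderiv ℝ F x d + r) + (r + -(F (x + d) - F x - fderiv ℝ F x d))
      = -F (x + d) := by abel
  rw [h6] at h4
  linarith

/-- Converse to `norm_step_le`, from `-F(x) = -c + F'(x) d + r` with `c ∈ C`; it lets the residual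
be replaced by the previous step in the rate estimate. -/
theorem feasNorm_le_step (h : NewtonSetting F C x₀ R f) (hθ0 : 0 ≤ θ) {x d : X} {r : Y}
    (hx : x ∈ ball x₀ R) (hr : r ∈ residuals F C x₀ θ x) (hd : d ∈ stepSet F C x r) :
    (1 - θ) * feasNorm C (fderiv ℝ F x₀) (-F x) ≤ (2 + mderiv f R ‖x - x₀‖) * ‖d‖ := by
  have h1 := h.feasNorm_fderiv_le hx d
  have h2 := ((h.mem_residuals_iff hθ0).1 hr).2
  have h3 := feasNorm_neg_of_mem (A := fderiv ℝ F x₀) hd.1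
  have h4 := feasNorm_add_le h.min (-(F x + fderiv ℝ F x d + r)) (fderiv ℝ F x d + r)
  have h5 := feasNorm_add_le h.min (fderiv ℝ F x d) r
  have h6 : -(F x + fderiv ℝ F x d + r) + (fderiv ℝ F x d + r) = -F x := by abel
  rw [h6] at h4
  linarith

/-- Bounds the residual by the distance to a solution `x + v`, as needed for Q-linear convergence.
-/
theorem feasNorm_le_of_mem (h : NewtonSetting F C x₀ R f) {x v : X} (hv : ‖x - x₀‖ + ‖v‖ < R)
    (hmem : F (x + v) ∈ C) :
    feasNorm C (fderiv ℝ F x₀) (-F x) ≤ (2 + mderiv f R ‖x - x₀‖) * ‖v‖ +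
      (f (‖x - x₀‖ + ‖v‖) - f ‖x - x₀‖ - mderiv f R ‖x - x₀‖ * ‖v‖) := by
  have hx : x ∈ ball x₀ R := by
    rw [mem_ball, dist_eq_norm]
    linarith [norm_nonneg v]
  have h1 := h.feasNorm_fderiv_le hx v
  have h2 := (h.feasNorm_linearization_le hv).1
  have h3 := feasNorm_neg_of_mem (A := fderiv ℝ F x₀) hmem
  have h4 := feasNorm_add_le h.min (-F (x + v))
    (fderiv ℝ F x v + (F (x + v) - F x - fderiv ℝ F x v))
  have h5 := feasNorm_add_le h.min (fderiv ℝ F x v) (F (x + v) - F x - fderiv ℝ F x v)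
  have h6 : -F (x + v) + (fderiv ℝ F x v + (F (x + v) - F x - fderiv ℝ F x v)) = -F x := by abel
  rw [h6] at h4
  linarith

theorem mem_ball_tbar_of_mem_setK (h : NewtonSetting F C x₀ R f) {x : X} {p : ℝ × ℝ}
    (hp : p ∈ setA f R) (hx : x ∈ setK F C x₀ f p.1 p.2) : x ∈ ball x₀ (tbar f R) := by
  rw [mem_ball, dist_eq_norm]
  exact hx.1.trans_lt (hp.2.1.trans_le h.scalar.lam_le_tbar)

theorem iteration_nonempty [CompleteSpace X] (h : NewtonSetting F C x₀ R f) {N : X → Set X}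
    (hN : N ∈ iterationFamily F C x₀ f R θ) {x : X} (hx : x ∈ ball x₀ (tbar f R)) :
    (N x).Nonempty := by
  obtain ⟨S, ⟨r, hr⟩, -, hNx⟩ := hN x hx
  obtain ⟨d, hd⟩ := h.stepSet_nonempty hx r
  refine ⟨x + d, ?_⟩
  rw [hNx]
  exact ⟨r, hr, by rwa [add_sub_cancel_left]⟩

theorem exists_residual {N : X → Set X}
    (hN : N ∈ iterationFamily F C x₀ f R θ) {x y : X} (hx : x ∈ ball x₀ (tbar f R))
    (hy : y ∈ N x) : ∃ r ∈ residuals F C x₀ θ x, y - x ∈ stepSet F C x r := by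
  obtain ⟨S, -, hS, hNx⟩ := hN x hx
  rw [hNx] at hy
  obtain ⟨r, hr, hyr⟩ := hy
  exact ⟨r, hS hr, hyr⟩

/-- One step of the iteration stays within the sets `K(t, ε)`. -/
theorem iteration_step [CompleteSpace X] (h : NewtonSetting F C x₀ R f) (hθ0 : 0 ≤ θ)
    (hθ : θ ≤ thetaTilde f R) {N : X → Set X} (hN : N ∈ iterationFamily F C x₀ f R θ)
    {p : ℝ × ℝ} (hp : p ∈ setA f R) {x y : X} (hx : x ∈ setK F C x₀ f p.1 p.2) (hy : y ∈ N x) :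
    ‖y - x‖ ≤ (nMap f R θ p).1 - p.1 ∧
      y ∈ setK F C x₀ f (nMap f R θ p).1 (nMap f R θ p).2 := by
  have hxb := h.mem_ball_tbar_of_mem_setK hp hx
  obtain ⟨r, hr, hd⟩ := exists_residual hN hxb hy
  have hxK := h.mem_setK_iff.1 hx
  have hstep := h.norm_step_le hθ0 hxb hr hd
  have hpR := hp.2.1.trans_le h.scalar.lam_le
  have hgle := h.scalar.mderiv_le (norm_nonneg (x - x₀)) hxK.1 hpR
  have hg := h.scalar.mderiv_lt hp.1 hp.2.1
  have hκ := h.scalar.kappa_nonneg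
  have hmul := h.scalar.mderiv_mul_step (θ := θ) hp
  have hnR := (h.scalar.nMap_fst_lt hθ0 hθ hp).trans_le h.scalar.lam_le
  have hnorm : ‖y - x‖ ≤ (nMap f R θ p).1 - p.1 := by
    have e1 : (nMap f R θ p).1 - p.1 = (1 + θ) * (f p.1 + p.2) / -mderiv f R p.1 := by
      rw [← hmul, mul_div_cancel_left₀]
      linarith
    rw [e1]
    refine hstep.trans (div_le_div₀ ?_ ?_ (by linarith) (by linarith))
    · exact mul_nonneg (by linarith) hp.2.2.2.2.le
    · exact mul_le_mul_of_nonneg_left hxK.2 (by linarith)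
  refine ⟨hnorm, h.mem_setK_iff.2 ⟨?_, ?_⟩⟩
  · have : y - x₀ = (y - x) + (x - x₀) := by abel
    rw [this]
    exact (norm_add_le _ _).trans (by linarith)
  · have hnext := h.feasNorm_next_le hθ0 hr hd (by linarith)
    rw [add_sub_cancel] at hnext
    have herr := h.scalar.linError_mono (norm_nonneg (x - x₀)) hxK.1 (norm_nonneg (y - x)) hnorm
      (by linarith)
    rw [add_sub_cancel] at herr
    rw [h.scalar.add_nMap_eq hp]
    have := mul_le_mul_of_nonneg_left hxK.2 hθ0
    linarith

end NewtonSetting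

/-! ### Limits of dominated sequences and linear rates. -/

section Limits

variable {E : Type*} [NormedAddCommGroup E]

theorem norm_sub_le_of_steps {y : ℕ → E} {t : ℕ → ℝ}
    (hstep : ∀ k, ‖y (k + 1) - y k‖ ≤ t (k + 1) - t k) {k m : ℕ} (hkm : k ≤ m) :
    ‖y m - y k‖ ≤ t m - t k := by
  induction m, hkm using Nat.le_induction with
  | base => simp
  | succ m _ ih =>
    have : y (m + 1) - y k = (y (m + 1) - y m) + (y m - y k) := by abel
    rw [this]
    exact (norm_add_le _ _).trans (by linarith [hstep m])

theorem exists_limit_of_steps [CompleteSpace E] {y : ℕ → E} {t : ℕ → ℝ} {tt : ℝ}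
    (hstep : ∀ k, ‖y (k + 1) - y k‖ ≤ t (k + 1) - t k) (ht : Tendsto t atTop (𝓝 tt)) :
    ∃ xs, Tendsto y atTop (𝓝 xs) ∧ ∀ k, ‖xs - y k‖ ≤ tt - t k := by
  have hsum : Summable fun k => t (k + 1) - t k := by
    refine summable_of_sum_range_le (c := tt - t 0)
      (fun k => (norm_nonneg _).trans (hstep k)) fun n => ?_
    rw [Finset.sum_range_sub]
    have hmono : Monotone t := monotone_nat_of_le_succ fun k => by
      linarith [(norm_nonneg _).trans (hstep k)]
    linarith [hmono.ge_of_tendsto ht n]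
  have hc : CauchySeq y := cauchySeq_of_dist_le_of_summable _ (fun k => by
    rw [dist_comm, dist_eq_norm]
    exact hstep k) hsum
  obtain ⟨xs, hxs⟩ := cauchySeq_tendsto_of_complete hc
  refine ⟨xs, hxs, fun k => ?_⟩
  refine le_of_tendsto_of_tendsto (hxs.sub_const (y k)).norm (ht.sub_const (t k)) ?_
  filter_upwards [eventually_ge_atTop k] with m hm
  exact norm_sub_le_of_steps hstep hm

/-- Linear convergence of a sequence whose steps are controlled by residuals `P k`, up to
quadratic terms. -/
theorem eventually_norm_le_of_residuals {y : ℕ → E} {xs : E} (hy : Tendsto y atTop (𝓝 xs))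
    {P : ℕ → ℝ} {a b L θ c : ℝ} (ha : 0 ≤ a) (hL : 0 ≤ L) (hθ0 : 0 ≤ θ)
    (hθ1 : θ < 1) (hP : ∀ k, 0 ≤ P k)
    (hstep : ∀ k, ‖y (k + 1) - y k‖ ≤ a * P k)
    (hres : ∀ k, P (k + 1) ≤ θ * P k + L * ‖y (k + 1) - y k‖ ^ 2)
    (hlow : ∀ k, P k ≤ b * ‖xs - y k‖ + L * ‖xs - y k‖ ^ 2)
    (hc : a * θ / (1 - θ) * b < c) :
    ∀ᶠ k in atTop, ‖xs - y (k + 1)‖ ≤ c * ‖xs - y k‖ := by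
  -- a small slack `η` for the quadratic terms
  obtain ⟨η, hη0, hηθ, hηc⟩ : ∃ η > 0, θ + η < 1 ∧ a * (θ + η) / (1 - (θ + η)) * (b + η) < c := by
    have hcont : ContinuousAt (fun η : ℝ => a * (θ + η) / (1 - (θ + η)) * (b + η)) 0 := by
      refine ContinuousAt.mul (ContinuousAt.div (by fun_prop) (by fun_prop) ?_) (by fun_prop)
      simp only [add_zero]
      linarith
    have h1 : ∀ᶠ η in 𝓝 (0 : ℝ), a * (θ + η) / (1 - (θ + η)) * (b + η) < c :=
      hcont.eventually_lt_const (by simpa using hc)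
    have h2 : ∀ᶠ η in 𝓝 (0 : ℝ), θ + η < 1 :=
      (show ContinuousAt (fun η : ℝ => θ + η) 0 by fun_prop).eventually_lt_const
        (by simpa using hθ1)
    obtain ⟨η, ⟨h1, h2⟩, h3⟩ := (((h1.and h2).filter_mono nhdsWithin_le_nhds).and
      (self_mem_nhdsWithin (a := (0 : ℝ)) (s := Ioi 0))).exists
    exact ⟨η, h3, h2, h1⟩
  have hd : Tendsto (fun k => ‖y (k + 1) - y k‖) atTop (𝓝 0) := by
    simpa using (((tendsto_add_atTop_iff_nat 1).2 hy).sub hy).norm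
  have he : Tendsto (fun k => ‖xs - y k‖) atTop (𝓝 0) := by
    simpa using (hy.const_sub xs).norm
  have h1 : ∀ᶠ k in atTop, L * a * ‖y (k + 1) - y k‖ < η :=
    (hd.const_mul (L * a)).eventually_lt_const (by simpa using hη0)
  have h2 : ∀ᶠ k in atTop, L * ‖xs - y k‖ < η :=
    (he.const_mul L).eventually_lt_const (by simpa using hη0)
  obtain ⟨n, hn⟩ := eventually_atTop.1 (h1.and h2)
  filter_upwards [eventually_ge_atTop n] with k hk
  -- One factor of the squared step is bounded by `a * P`, the other is small; so the quadratic term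
  -- costs only `η * P`.
  have hP' : ∀ j, P (k + j) ≤ (θ + η) ^ j * P k := by
    intro j
    induction j with
    | zero => simp
    | succ j ih =>
      have e1 := hres (k + j)
      have e2 : L * ‖y (k + j + 1) - y (k + j)‖ ^ 2 ≤ η * P (k + j) := by
        calc L * ‖y (k + j + 1) - y (k + j)‖ ^ 2
            = L * ‖y (k + j + 1) - y (k + j)‖ * ‖y (k + j + 1) - y (k + j)‖ := by ring
          _ ≤ L * ‖y (k + j + 1) - y (k + j)‖ * (a * P (k + j)) :=
              mul_le_mul_of_nonneg_left (hstep _) (by positivity)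
          _ = L * a * ‖y (k + j + 1) - y (k + j)‖ * P (k + j) := by ring
          _ ≤ η * P (k + j) :=
              mul_le_mul_of_nonneg_right (hn (k + j) (by omega)).1.le (hP _)
      calc P (k + (j + 1)) ≤ (θ + η) * P (k + j) := by
            rw [← add_assoc]
            linarith
        _ ≤ (θ + η) * ((θ + η) ^ j * P k) := mul_le_mul_of_nonneg_left ih (by linarith)
        _ = (θ + η) ^ (j + 1) * P k := by ring
  have hdist : dist (y (k + 1)) xs ≤ a * (θ + η) * P k / (1 - (θ + η)) := by
    refine dist_le_of_le_geometric_of_tendsto₀ (f := fun j => y (k + 1 + j)) (θ + η) _ hηθ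
      (fun j => ?_) ?_
    · rw [dist_comm, dist_eq_norm]
      have e1 := hstep (k + 1 + j)
      have e2 := hP' (j + 1)
      rw [show k + (j + 1) = k + 1 + j by omega] at e2
      refine e1.trans ((mul_le_mul_of_nonneg_left e2 ha).trans (le_of_eq ?_))
      ring
    · simpa [add_comm] using (tendsto_add_atTop_iff_nat (k + 1)).2 hy
  have hPk : P k ≤ (b + η) * ‖xs - y k‖ := by
    have := mul_le_mul_of_nonneg_right (hn k hk).2.le (norm_nonneg (xs - y k))
    linarith [hlow k]
  rw [dist_comm, dist_eq_norm] at hdist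
  have hpos : 0 < 1 - (θ + η) := by linarith
  calc ‖xs - y (k + 1)‖ ≤ a * (θ + η) * P k / (1 - (θ + η)) := hdist
    _ = a * (θ + η) / (1 - (θ + η)) * P k := by ring
    _ ≤ a * (θ + η) / (1 - (θ + η)) * ((b + η) * ‖xs - y k‖) :=
        mul_le_mul_of_nonneg_left hPk (by positivity)
    _ = a * (θ + η) / (1 - (θ + η)) * (b + η) * ‖xs - y k‖ := by ring
    _ ≤ c * ‖xs - y k‖ := mul_le_mul_of_nonneg_right hηc.le (norm_nonneg _)

/-- In `ℝ≥0∞` one has `0 / 0 = 0`, so iterates that reach the limit need no separate case. -/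
theorem limsup_enorm_div_le {y : ℕ → E} {xs : E} {c : ℝ} (hc : 0 ≤ c)
    (h : ∀ᶠ k in atTop, ‖xs - y (k + 1)‖ ≤ c * ‖xs - y k‖) :
    limsup (fun k => ‖xs - y (k + 1)‖ₑ / ‖xs - y k‖ₑ) atTop ≤ ENNReal.ofReal c := by
  refine limsup_le_of_le (by isBoundedDefault) ?_
  filter_upwards [h] with k hk
  refine ENNReal.div_le_of_le_mul ?_
  rw [← ofReal_norm, ← ofReal_norm, ← ENNReal.ofReal_mul hc]
  exact ENNReal.ofReal_le_ofReal hk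

end Limits

section Rates

/-- The threshold is the positive root of `(4 + κ) θ² + 4 (κ + 1) θ - κ`, and negativity of this
quadratic is the claim with denominators cleared. -/
theorem rate_lt_one {κ θ : ℝ} (hκ : 0 < κ) (hθ0 : 0 ≤ θ) (hθ1 : θ < 1)
    (hθ : θ < (-2 * (κ + 1) + √(4 * (κ + 1) ^ 2 + κ * (4 + κ))) / (4 + κ)) :
    (1 + θ) / (1 - θ) * ((1 + θ) / 2 + 2 * θ / κ) < 1 := by
  rw [lt_div_iff₀ (by linarith)] at hθ
  have h1 : θ * (4 + κ) + 2 * (κ + 1) < √(4 * (κ + 1) ^ 2 + κ * (4 + κ)) := by linarith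
  have h2 := (Real.lt_sqrt (by positivity)).1 h1
  have h3 : (4 + κ) * ((4 + κ) * θ ^ 2 + 4 * (κ + 1) * θ - κ) < 0 := by linarith
  have h4 : (4 + κ) * θ ^ 2 + 4 * (κ + 1) * θ - κ < 0 :=
    neg_of_mul_neg_right h3 (by linarith)
  have h5 : (1 + θ) / (1 - θ) * ((1 + θ) / 2 + 2 * θ / κ)
      = (1 + θ) * ((1 + θ) * κ + 4 * θ) / ((1 - θ) * (2 * κ)) := by
    have : 1 - θ ≠ 0 := by linarith
    field_simp
    ring
  rw [h5, div_lt_one (mul_pos (by linarith) (by linarith))]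
  nlinarith

/-- The strict gap is what absorbs the slack in `eventually_norm_le_of_residuals`. -/
theorem asymptotic_rate_lt {κ θ : ℝ} (hκ : 0 < κ) (hθ0 : 0 ≤ θ) (hθ1 : θ < 1) :
    (1 + θ) / κ * θ / (1 - θ) * (2 - κ) < (1 + θ) / (1 - θ) * ((1 + θ) / 2 + 2 * θ / κ) := by
  have h1 : 0 < 1 - θ := by linarith
  have h2 : (1 + θ) / (1 - θ) * ((1 + θ) / 2 + 2 * θ / κ) - (1 + θ) / κ * θ / (1 - θ) * (2 - κ)
      = (1 + θ) / (1 - θ) * ((1 + θ) / 2 + θ) := by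
    field_simp
    ring
  have h3 : 0 < (1 + θ) / (1 - θ) * ((1 + θ) / 2 + θ) := by positivity
  linarith

end Rates

/-! ### Convergence and rates of the Newton iterates. -/

namespace NewtonSetting

variable {F : X → Y} {C : ConvexCone ℝ Y} {x₀ : X} {R θ : ℝ} {f : ℝ → ℝ} {N : X → Set X}
  {t ε : ℕ → ℝ} {y : ℕ → X}

/-- Formulated for finite initial segments, because continuability must be known before an infinite
sequence exists. -/
theorem iterates_mem_setK [CompleteSpace X] (h : NewtonSetting F C x₀ R f) (hθ0 : 0 ≤ θ)
    (hθ : θ ≤ thetaTilde f R) (hN : N ∈ iterationFamily F C x₀ f R θ)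
    (hA : ∀ k, (t k, ε k) ∈ setA f R)
    (htε : ∀ k, (t (k + 1), ε (k + 1)) = nMap f R θ (t k, ε k))
    (hy₀ : y 0 ∈ setK F C x₀ f (t 0) (ε 0)) {m : ℕ} (hy : ∀ k < m, y (k + 1) ∈ N (y k)) :
    y m ∈ setK F C x₀ f (t m) (ε m) := by
  induction m with
  | zero => exact hy₀
  | succ m ih =>
    have := (h.iteration_step hθ0 hθ hN (hA m) (ih fun k hk => hy k (by omega))
      (hy m (by omega))).2
    rwa [← htε] at this

theorem norm_iterates_sub_le [CompleteSpace X] (h : NewtonSetting F C x₀ R f) (hθ0 : 0 ≤ θ)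
    (hθ : θ ≤ thetaTilde f R) (hN : N ∈ iterationFamily F C x₀ f R θ)
    (hA : ∀ k, (t k, ε k) ∈ setA f R)
    (htε : ∀ k, (t (k + 1), ε (k + 1)) = nMap f R θ (t k, ε k))
    (hyK : ∀ k, y k ∈ setK F C x₀ f (t k) (ε k)) (hy : ∀ k, y (k + 1) ∈ N (y k)) (k : ℕ) :
    ‖y (k + 1) - y k‖ ≤ t (k + 1) - t k := by
  have := (h.iteration_step hθ0 hθ hN (hA k) (hyK k) (hy k)).1
  rwa [← htε] at this

/-- The minimal corrections `σ k` with `F'(x₀) (σ k) + F(y k) ∈ C` tend to `0`, and `C` is closed.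
-/
theorem limit_mem_cone (h : NewtonSetting F C x₀ R f) {xs : X} (hxs : xs ∈ ball x₀ R)
    (hy : Tendsto y atTop (𝓝 xs))
    (hres : Tendsto (fun k => feasNorm C (fderiv ℝ F x₀) (-F (y k))) atTop (𝓝 0)) :
    F xs ∈ C := by
  choose σ hσ hσ' using fun k => h.min (-F (y k))
  have h1 : Tendsto σ atTop (𝓝 0) := by
    rw [tendsto_zero_iff_norm_tendsto_zero]
    simpa only [hσ'] using hres
  have h2 : Tendsto (fun k => fderiv ℝ F x₀ (σ k) - -F (y k)) atTop
      (𝓝 (fderiv ℝ F x₀ 0 - -F xs)) :=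
    (((fderiv ℝ F x₀).continuous.tendsto 0).comp h1).sub
      ((h.differentiableAt xs hxs).continuousAt.tendsto.comp hy).neg
  rw [map_zero, zero_sub, neg_neg] at h2
  exact h.isClosed.mem_of_tendsto h2 (Eventually.of_forall hσ)

theorem norm_iterates_sub_le_feasNorm [CompleteSpace X] (h : NewtonSetting F C x₀ R f)
    (hθ0 : 0 ≤ θ) (hN : N ∈ iterationFamily F C x₀ f R θ) (hκ : 0 < kappa f R)
    {x z : X} (hx : ‖x - x₀‖ < lam f R) (hz : z ∈ N x) :
    ‖z - x‖ ≤ (1 + θ) / kappa f R * feasNorm C (fderiv ℝ F x₀) (-F x) := by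
  have hxb : x ∈ ball x₀ (tbar f R) := by
    rw [mem_ball, dist_eq_norm]
    exact hx.trans_le h.scalar.lam_le_tbar
  obtain ⟨r, hr, hd⟩ := exists_residual hN hxb hz
  have h1 := h.norm_step_le hθ0 hxb hr hd
  have h2 := h.scalar.mderiv_lt (norm_nonneg _) hx
  refine h1.trans ?_
  rw [div_mul_eq_mul_div]
  have h3 : 0 ≤ (1 + θ) * feasNorm C (fderiv ℝ F x₀) (-F x) :=
    mul_nonneg (by linarith) (feasNorm_nonneg _)
  exact div_le_div_of_nonneg_left h3 hκ (by linarith)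

theorem linError_le_leftDeriv (h : NewtonSetting F C x₀ R f) (hl : lam f R < R) {s b : ℝ}
    (hs : 0 ≤ s) (hb : 0 ≤ b) (hsb : s + b ≤ lam f R) :
    f (s + b) - f s - mderiv f R s * b ≤
      leftDeriv (mderiv f R) (lam f R) / 2 * b ^ 2 := by
  have := h.scalar.linError_le_sq (L := leftDeriv (mderiv f R) (lam f R)) hs hb
    (hsb.trans_lt hl) (fun x hx => by
      have := h.scalar.mderiv_sub_le_leftDeriv hl hs (t := s + x) (by linarith [hx.1])
        (by linarith [hx.2])
      rwa [add_sub_cancel_left] at this)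
  linarith

theorem feasNorm_iterate_le (h : NewtonSetting F C x₀ R f) (hθ0 : 0 ≤ θ)
    (hN : N ∈ iterationFamily F C x₀ f R θ) (hl : lam f R < R)
    {x z : X} (hx : ‖x - x₀‖ < lam f R) (hxz : ‖x - x₀‖ + ‖z - x‖ ≤ lam f R) (hz : z ∈ N x) :
    feasNorm C (fderiv ℝ F x₀) (-F z) ≤ θ * feasNorm C (fderiv ℝ F x₀) (-F x) +
        leftDeriv (mderiv f R) (lam f R) / 2 * ‖z - x‖ ^ 2 ∧
      (1 - θ) * feasNorm C (fderiv ℝ F x₀) (-F x) ≤ (2 - kappa f R) * ‖z - x‖ := by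
  have hxb : x ∈ ball x₀ (tbar f R) := by
    rw [mem_ball, dist_eq_norm]
    exact hx.trans_le h.scalar.lam_le_tbar
  obtain ⟨r, hr, hd⟩ := exists_residual hN hxb hz
  constructor
  · have h1 := h.feasNorm_next_le hθ0 hr hd (hxz.trans_lt hl)
    rw [add_sub_cancel] at h1
    have h2 := h.linError_le_leftDeriv hl (norm_nonneg _) (norm_nonneg _) hxz
    linarith
  · refine (h.feasNorm_le_step hθ0 (h.mem_ball_R_of_mem_ball_tbar hxb) hr hd).trans ?_
    have h2 := h.scalar.mderiv_lt (norm_nonneg _) hx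
    exact mul_le_mul_of_nonneg_right (by linarith) (norm_nonneg _)

theorem feasNorm_le_of_limit (h : NewtonSetting F C x₀ R f) (hl : lam f R < R)
    {x xs : X} (hx : ‖x - x₀‖ < lam f R) (hxs : ‖x - x₀‖ + ‖xs - x‖ ≤ lam f R)
    (hmem : F xs ∈ C) :
    feasNorm C (fderiv ℝ F x₀) (-F x) ≤ (2 - kappa f R) * ‖xs - x‖ +
      leftDeriv (mderiv f R) (lam f R) / 2 * ‖xs - x‖ ^ 2 := by
  have h1 := h.feasNorm_le_of_mem (hxs.trans_lt hl) (by rwa [add_sub_cancel])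
  have h2 := h.linError_le_leftDeriv hl (norm_nonneg _) (norm_nonneg _) hxs
  have h3 := h.scalar.mderiv_lt (norm_nonneg _) hx
  have h4 : (2 + mderiv f R ‖x - x₀‖) * ‖xs - x‖ ≤ (2 - kappa f R) * ‖xs - x‖ :=
    mul_le_mul_of_nonneg_right (by linarith) (norm_nonneg _)
  linarith

theorem norm_step_le_prev_step [CompleteSpace X] (h : NewtonSetting F C x₀ R f) (hθ0 : 0 ≤ θ)
    (hθ1 : θ < 1) (hN : N ∈ iterationFamily F C x₀ f R θ) (hκ : 0 < kappa f R)
    (hl : lam f R < R) {x z w : X} (hx : ‖x - x₀‖ < lam f R)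
    (hxz : ‖x - x₀‖ + ‖z - x‖ ≤ lam f R) (hz : z ∈ N x) (hz' : ‖z - x₀‖ < lam f R)
    (hw : w ∈ N z) :
    ‖z - w‖ ≤ (1 + θ) / (1 - θ) *
      ((1 + θ) / 2 * (leftDeriv (mderiv f R) (lam f R) / |mderiv f R (lam f R)|) * ‖z - x‖
        + θ * ((2 + mderiv f R (lam f R)) / |mderiv f R (lam f R)|)) * ‖z - x‖ := by
  rw [h.scalar.mderiv_lam hl, abs_neg, abs_of_pos hκ, norm_sub_rev]
  have h1 := h.norm_iterates_sub_le_feasNorm hθ0 hN hκ hz' hw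
  obtain ⟨h2, h3⟩ := h.feasNorm_iterate_le hθ0 hN hl hx hxz hz
  have hD := h.scalar.leftDeriv_nonneg hl
  set D := leftDeriv (mderiv f R) (lam f R)
  set κ := kappa f R
  set b := ‖z - x‖
  have hb : 0 ≤ b := norm_nonneg _
  have hθ' : 0 < 1 - θ := by linarith
  have h4 : feasNorm C (fderiv ℝ F x₀) (-F x) ≤ (2 - κ) * b / (1 - θ) := by
    rw [le_div_iff₀ hθ']
    linarith
  have h5 : feasNorm C (fderiv ℝ F x₀) (-F z) ≤ θ * ((2 - κ) * b / (1 - θ)) + D / 2 * b ^ 2 :=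
    h2.trans (by linarith [mul_le_mul_of_nonneg_left h4 hθ0])
  -- The factor `(1 + θ)/(1 - θ) ≥ 1` is not needed on the quadratic term; it is inserted to reach
  -- the stated form.
  have h6 : D / 2 * b ^ 2 ≤ (1 + θ) / (1 - θ) * (D / 2 * b ^ 2) := by
    refine le_mul_of_one_le_left (by positivity) ?_
    rw [one_le_div hθ']
    linarith
  calc ‖w - z‖ ≤ (1 + θ) / κ * feasNorm C (fderiv ℝ F x₀) (-F z) := h1
    _ ≤ (1 + θ) / κ * (θ * ((2 - κ) * b / (1 - θ)) + (1 + θ) / (1 - θ) * (D / 2 * b ^ 2)) :=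
        mul_le_mul_of_nonneg_left (by linarith) (by positivity)
    _ = (1 + θ) / (1 - θ) * ((1 + θ) / 2 * (D / κ) * b + θ * ((2 + -κ) / κ)) * b := by
        field_simp
        ring

end NewtonSetting

end InexactNewton

/-! ### The main theorem. -/

open InexactNewton in
theorem theorem2 {X Y : Type*}
    [NormedAddCommGroup X] [NormedSpace ℝ X] [CompleteSpace X]
    [NormedAddCommGroup Y] [NormedSpace ℝ Y] [CompleteSpace Y]
    -- `X` is reflexive
    (hrefl : Function.Surjective (NormedSpace.inclusionInDoubleDual ℝ X))
    (C : ConvexCone ℝ Y) (hCne : (C : Set Y).Nonempty) (hCcl : IsClosed (C : Set Y))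
    (Ω : Set X) (hΩ : IsOpen Ω) (F : X → Y) (hF : ContDiffOn ℝ 1 F Ω)
    (x₀ : X) (hx₀ : x₀ ∈ Ω) (hRob : RobinsonCondition F C x₀)
    (R : ℝ) (hR : 0 < R) (f : ℝ → ℝ) (hf : IsMajorant F C Ω x₀ R f)
    (hKH : (setNorm (invProcess F C x₀ (-F x₀)) : EReal) ≤ ((f 0 : ℝ) : EReal))
    (θ : ℝ) (hθ0 : 0 ≤ θ) (hθ : θ ≤ thetaTilde f R)
    (N : X → Set X) (hN : N ∈ iterationFamily F C x₀ f R θ)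
    (t ε : ℕ → ℝ) (hA : (t 0, ε 0) ∈ setA f R)
    (htε : ∀ k, (t (k + 1), ε (k + 1)) = nMap f R θ (t k, ε k))
    (y₀ : X) (hy₀ : y₀ ∈ setK F C x₀ f (t 0) (ε 0)) :
    -- the scalar sequences are well defined: they stay in the domain of `n_θ`, and in `𝒜`
    (∀ k, t k ∈ Ico 0 (tbar f R) ∧ 0 ≤ ε k ∧ mderiv f R (t k) ≠ 0 ∧ (t k, ε k) ∈ setA f R) ∧
    -- the iteration is well defined: whatever choices are made, it can always be continued
    (∀ (m : ℕ) (y : ℕ → X), y 0 = y₀ → (∀ k < m, y (k + 1) ∈ N (y k)) →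
      y m ∈ ball x₀ (tbar f R) ∧ (N (y m)).Nonempty) ∧
    (∃ y : ℕ → X, y 0 = y₀ ∧ ∀ k, y (k + 1) ∈ N (y k)) ∧
    ∃ tt εε : ℝ,
      StrictMono t ∧ tt ∈ Ioc 0 (lam f R) ∧ Tendsto t atTop (𝓝 tt) ∧
      Monotone ε ∧ εε ∈ Icc 0 (kappa f R * lam f R) ∧ Tendsto ε atTop (𝓝 εε) ∧
      (∀ k, f (t k) + ε k ≤ ((1 + θ ^ 2) / 2) ^ k * (f (t 0) + ε 0)) ∧
      ∀ y : ℕ → X, y 0 = y₀ → (∀ k, y (k + 1) ∈ N (y k)) →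
        (∀ k, y k ∈ setK F C x₀ f (t k) (ε k)) ∧
        (∀ k, (setNorm (invProcess F C x₀ (-F (y k))) : EReal) ≤ ((f (t k) + ε k : ℝ) : EReal)) ∧
        (∀ k, y k ∈ ball x₀ (lam f R)) ∧
        ∃ xs : X, xs ∈ closedBall x₀ (lam f R) ∧ xs ∈ Ω ∧ Tendsto y atTop (𝓝 xs) ∧ F xs ∈ C ∧
          (∀ k, ‖y (k + 1) - y k‖ ≤ t (k + 1) - t k) ∧
          (∀ k, ‖xs - y k‖ ≤ tt - t k) ∧
          ((∃ s ∈ Ioo 0 R, f s < 0) → lam f R < R →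
            (∀ k, ‖y (k + 1) - y (k + 2)‖ ≤
              (1 + θ) / (1 - θ) *
                ((1 + θ) / 2 * (leftDeriv (mderiv f R) (lam f R) / |mderiv f R (lam f R)|)
                    * ‖y (k + 1) - y k‖
                  + θ * ((2 + mderiv f R (lam f R)) / |mderiv f R (lam f R)|))
                * ‖y (k + 1) - y k‖) ∧
            (θ < (-2 * (kappa f R + 1)
                + √(4 * (kappa f R + 1) ^ 2 + kappa f R * (4 + kappa f R))) / (4 + kappa f R) →
              (1 + θ) / (1 - θ) * ((1 + θ) / 2 + 2 * θ / kappa f R) < 1 ∧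
              limsup (fun k => ‖xs - y (k + 1)‖ₑ / ‖xs - y k‖ₑ) atTop ≤
                ENNReal.ofReal ((1 + θ) / (1 - θ) * ((1 + θ) / 2 + 2 * θ / kappa f R)))) := by
  have hs := hf.scalarMajorant
  have h := hf.newtonSetting hrefl hCne hCcl hΩ hF hRob
  have hθ1 := hs.theta_lt_one hθ
  have hmem := hs.mem_setA_of_nMap hθ0 hθ hA htε
  have hmono := hs.strictMono_of_nMap hθ0 hθ hA htε
  have hεmono := hs.monotone_of_nMap hθ0 hθ hA htε
  have hκ0 := hs.kappa_nonneg
  have hK : ∀ (m : ℕ) (y : ℕ → X), y 0 = y₀ → (∀ k < m, y (k + 1) ∈ N (y k)) →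
      y m ∈ setK F C x₀ f (t m) (ε m) := by
    intro m y hy0 hy
    exact h.iterates_mem_setK hθ0 hθ hN hmem htε (by rwa [hy0]) hy
  have hwell : ∀ (m : ℕ) (y : ℕ → X), y 0 = y₀ → (∀ k < m, y (k + 1) ∈ N (y k)) →
      y m ∈ ball x₀ (tbar f R) ∧ (N (y m)).Nonempty := by
    intro m y hy0 hy
    have hb := h.mem_ball_tbar_of_mem_setK (hmem m) (hK m y hy0 hy)
    exact ⟨hb, h.iteration_nonempty hN hb⟩
  refine ⟨fun k => ?_, hwell, ?_, ?_⟩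
  · obtain ⟨h1, h2, h3, h4⟩ := hmem k
    exact ⟨⟨h1, h2.trans_le hs.lam_le_tbar⟩, h3,
      (by linarith [hs.mderiv_lt h1 h2] : mderiv f R (t k) < 0).ne, hmem k⟩
  · classical
    -- The fallback value `x` is never taken: `hwell` gives nonemptiness for each finite segment
    -- already built.
    let y : ℕ → X := fun n => Nat.rec y₀
      (fun _ x => if hx : (N x).Nonempty then hx.some else x) n
    have hsucc : ∀ k, (N (y k)).Nonempty → y (k + 1) ∈ N (y k) := by
      intro k hk
      have : y (k + 1) = if hx : (N (y k)).Nonempty then hx.some else y k := rfl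
      rw [this, dif_pos hk]
      exact hk.some_mem
    have hall : ∀ m, ∀ k < m, y (k + 1) ∈ N (y k) := by
      intro m
      induction m with
      | zero => simp
      | succ m ih =>
        intro k hk
        rcases Nat.lt_succ_iff_lt_or_eq.1 hk with hk | rfl
        · exact ih k hk
        · exact hsucc k (hwell k y rfl ih).2
    exact ⟨y, rfl, fun k => hall (k + 1) k (Nat.lt_succ_self k)⟩
  · have htbdd : ∀ k, t k ≤ lam f R := fun k => (hmem k).2.1.le
    have hεbdd : ∀ k, ε k ≤ kappa f R * lam f R := fun k =>
      (hmem k).2.2.2.1.trans (mul_le_mul_of_nonneg_left (htbdd k) hκ0)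
    obtain ⟨tt, htt⟩ : ∃ tt, Tendsto t atTop (𝓝 tt) :=
      ⟨_, tendsto_atTop_ciSup hmono.monotone ⟨lam f R, by rintro _ ⟨k, rfl⟩; exact htbdd k⟩⟩
    obtain ⟨εε, hεε⟩ : ∃ εε, Tendsto ε atTop (𝓝 εε) :=
      ⟨_, tendsto_atTop_ciSup hεmono
        ⟨kappa f R * lam f R, by rintro _ ⟨k, rfl⟩; exact hεbdd k⟩⟩
    have httl : tt ≤ lam f R := le_of_tendsto' htt htbdd
    have httR : tt < R := hs.lim_lt_of_nMap hθ0 hθ hA htε htt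
    have htt0 : 0 < tt := ((hmem 0).1.trans_lt (hmono zero_lt_one)).trans_le
      (hmono.monotone.ge_of_tendsto htt 1)
    refine ⟨tt, εε, hmono, ⟨htt0, httl⟩, htt, hεmono,
      ⟨ge_of_tendsto' hεε fun k => (hmem k).2.2.1, le_of_tendsto' hεε hεbdd⟩, hεε,
      hs.add_le_pow_of_nMap hθ0 hθ hA htε, fun y hy0 hy => ?_⟩
    have hyK : ∀ k, y k ∈ setK F C x₀ f (t k) (ε k) := fun k => hK k y hy0 fun j _ => hy j
    have hyt : ∀ k, ‖y k - x₀‖ ≤ t k := fun k => (hyK k).1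
    have hyl : ∀ k, ‖y k - x₀‖ < lam f R := fun k => (hyt k).trans_lt (hmem k).2.1
    have hstep := h.norm_iterates_sub_le hθ0 hθ hN hmem htε hyK hy
    obtain ⟨xs, hxs, hxs'⟩ := exists_limit_of_steps hstep htt
    have hxst : ‖xs - x₀‖ ≤ tt := by
      have : xs - x₀ = (xs - y 0) + (y 0 - x₀) := by abel
      rw [this]
      exact (norm_add_le _ _).trans (by linarith [hxs' 0, hyt 0])
    -- Here `tt < R` is essential: for `λ = R`, the closed ball of radius `λ` need not lie in `Ω`.
    have hxsR : xs ∈ ball x₀ R := by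
      rw [mem_ball, dist_eq_norm]
      exact hxst.trans_lt httR
    have hxsC : F xs ∈ C := h.limit_mem_cone hxsR hxs
      (squeeze_zero (fun k => feasNorm_nonneg _) (fun k => (h.mem_setK_iff.1 (hyK k)).2)
        (hs.tendsto_add_of_nMap hθ0 hθ hA htε))
    refine ⟨hyK, fun k => (hyK k).2, fun k => ?_, xs, ?_, hf.ball_subset hxsR, hxs, hxsC, hstep,
      hxs', fun hneg hl => ?_⟩
    · rw [mem_ball, dist_eq_norm]
      exact hyl k
    · rw [mem_closedBall, dist_eq_norm]
      exact hxst.trans httl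
    have hκ := hs.kappa_pos hneg
    have hsum : ∀ k, ‖y k - x₀‖ + ‖y (k + 1) - y k‖ ≤ lam f R := fun k => by
      linarith [hyt k, hstep k, htbdd (k + 1)]
    refine ⟨fun k => h.norm_step_le_prev_step hθ0 hθ1 hN hκ hl (hyl k) (hsum k) (hy k)
      (hyl (k + 1)) (hy (k + 1)), fun hθ2 => ⟨rate_lt_one hκ hθ0 hθ1 hθ2, ?_⟩⟩
    have hpos : 0 < 1 - θ := by linarith
    refine limsup_enorm_div_le (by positivity) ?_
    exact eventually_norm_le_of_residuals hxs (a := (1 + θ) / kappa f R) (b := 2 - kappa f R)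
      (L := leftDeriv (mderiv f R) (lam f R) / 2) (by positivity)
      (div_nonneg (hs.leftDeriv_nonneg hl) zero_le_two) hθ0 hθ1
      (P := fun k => feasNorm C (fderiv ℝ F x₀) (-F (y k))) (fun k => feasNorm_nonneg _)
      (fun k => h.norm_iterates_sub_le_feasNorm hθ0 hN hκ (hyl k) (hy k))
      (fun k => (h.feasNorm_iterate_le hθ0 hN hl (hyl k) (hsum k) (hy k)).1)
      (fun k => h.feasNorm_le_of_limit hl (hyl k) (by linarith [hyt k, hxs' k]) hxsC)
      (asymptotic_rate_lt hκ hθ0 hθ1)
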